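/- Let $U=\mathbb R^2$ with its Euclidean scalar product $\langle\cdot,\cdot\rangle$ and norm $|\cdot|$, and let $\Omega\subset U$ be a convex compact set with $0\in\operatorname{int}\Omega$. For $q_0=(x_0,y_0)\in U\times U$ consider the optimal control problem $$J(x)=\frac12\int_0^{+\infty}\langle x(t),x(t)\rangle\,dt\to\inf,\qquad \dot x=y,\quad \dot y=u,\quad u(t)\in\Omega,\qquad x(0)=x_0,\ y(0)=y_0,$$ over measurable controls $u:[0,\infty)\to\Omega$. An admissible trajectory is $q=(x,y):[0,\infty)\to U\times U$, with $x,y$ locally absolutely continuous and the equations holding for almost every $t$. Let $\mathcal B(q_0)\in[0,\infty]$ be the infimum of $J$ over all admissible trajectories with initial point $q_0$. An adjoint function of an admissible trajectory $q=(x,y)$ with control $u$ is a locally absolutely continuous function $p=(\phi,\psi):[0,\infty)\to U\times U$ with $$\dot\phi=x,\qquad \dot\psi=-\phi,\qquad \langle\psi(t),u(t)\rangle=\max_{v\in\Omega}\langle\psi(t),v\rangle\ \text{ for almost every } t\ge0$$ (the Pontryagin maximum principle in normal form). The pair $p=(\phi,\psi)$ is identified with the linear form $(dx,dy)\mapsto\langle\phi,dx\rangle+\langle\psi,dy\rangle$.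 Then the following holds. 1. For every $q_0\in U\times U$ one has $\mathcal B(q_0)<\infty$, there exists a unique optimal trajectory $\widehat q(t,q_0)$, $t\ge0$, with initial point $q_0$, and it has a unique adjoint function $\widehat p(t,q_0)$, $t\ge 0$. 2. For every $q_0$ there is a time $T(q_0)\ge0$ such that $\widehat q(t,q_0)=0$ and $\widehat p(t,q_0)=0$ for all $t\ge T(q_0)$, while $\widehat q(t,q_0)\ne0$ and $\widehat p(t,q_0)\ne0$ for $0\le t<T(q_0)$. The function $T$ is continuous, and there are constants $C_1,C_2>0$, depending only on $\Omega$, such that for all $q_0=(x_0,y_0)$ $$C_1\max\{\sqrt{|x_0|},|y_0|\}\le T(q_0)\le C_2\max\{\sqrt{|x_0|},|y_0|\}.$$ 3. The function $\mathcal B$ is differentiable on $U\times U$, and the map $E:q_0\mapsto\widehat p(0,q_0)=(\phi_0,\psi_0)$ satisfies $E(q_0)=-\mathcal B'(q_0)$ for all $q_0$. The map $E:U\times U\to U\times U$ is locally Lipschitz and bijective, and there are constants $C_3,C_4>0$, depending only on $\Omega$, such that for all $q_0=(x_0,y_0)$ $$C_3\max\{\sqrt{|x_0|},|y_0|\}\le\max\{\sqrt[3]{|\phi_0|},\sqrt[4]{|\psi_0|}\}\le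 C_4\max\{\sqrt{|x_0|},|y_0|\}.$$ -/

import Mathlib

open Set MeasureTheory
open scoped ENNReal

noncomputable section

namespace ModelProblem

/-- The two-dimensional Euclidean space `U` of positions and of controls. -/
abbrev Plane : Type := EuclideanSpace ℝ (Fin 2)

/-- The phase space `M = U ⊕ U` of pairs `q = (x, y)`; also used for pairs `p = (φ, ψ)` of adjoint
variables, the covector `p` being `(dx, dy) ↦ ⟨φ, dx⟩ + ⟨ψ, dy⟩`. -/
abbrev Phase : Type := Plane × Plane

/-- `f` is a locally absolutely continuous solution of `ḟ = g` on `[0, ∞)`. -/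
def SolvesDeriv (f g : ℝ → Plane) : Prop :=
  ∀ t : ℝ, 0 ≤ t →
    IntervalIntegrable g volume 0 t ∧ f t = f 0 + ∫ s in (0 : ℝ)..t, g s

/-- `q = (x, y)` is the trajectory on `[0, ∞)` of `ẋ = y`, `ẏ = u` that starts at `q₀` and is
driven by the measurable control `u` with values in `Ω`. Only times `t ≥ 0` matter. -/
structure IsControlled (Ω : Set Plane) (q₀ : Phase) (q : ℝ → Phase) (u : ℝ → Plane) : Prop where
  init : q 0 = q₀
  deriv_x : SolvesDeriv (fun t => (q t).1) (fun t => (q t).2)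
  deriv_y : SolvesDeriv (fun t => (q t).2) u
  mem : ∀ᵐ t ∂(volume.restrict (Ici (0 : ℝ))), u t ∈ Ω

/-- Admissible trajectories with initial point `q₀`. -/
def IsAdmissible (Ω : Set Plane) (q₀ : Phase) (q : ℝ → Phase) : Prop :=
  ∃ u : ℝ → Plane, IsControlled Ω q₀ q u

/-- The functional `J = ½ ∫₀^∞ ⟨x(t), x(t)⟩ dt`, with values in `[0, ∞]`. -/
def cost (q : ℝ → Phase) : ℝ≥0∞ :=
  2⁻¹ * ∫⁻ t in Ici (0 : ℝ), ENNReal.ofReal (inner ℝ (q t).1 (q t).1)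

/-- Optimal trajectories with initial point `q₀`. -/
def IsOptimal (Ω : Set Plane) (q₀ : Phase) (q : ℝ → Phase) : Prop :=
  IsAdmissible Ω q₀ q ∧ ∀ q' : ℝ → Phase, IsAdmissible Ω q₀ q' → cost q ≤ cost q'

/-- The Bellman function, the infimum of `J` over the admissible trajectories from `q₀`. -/
def bellman (Ω : Set Plane) (q₀ : Phase) : ℝ≥0∞ :=
  ⨅ (q : ℝ → Phase) (_ : IsAdmissible Ω q₀ q), cost q

/-- `p = (φ, ψ)` is an adjoint function on `[0, ∞)` of the trajectory `q = (x, y)` in the sense of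
the Pontryagin maximum principle (in normal form): `φ̇ = x`, `ψ̇ = -φ`, and at almost every time
the control of `q` maximizes `⟨ψ, ·⟩` over `Ω`. -/
def IsAdjoint (Ω : Set Plane) (q₀ : Phase) (q p : ℝ → Phase) : Prop :=
  SolvesDeriv (fun t => (p t).1) (fun t => (q t).1) ∧
  SolvesDeriv (fun t => (p t).2) (fun t => -(p t).1) ∧
  ∃ u : ℝ → Plane, IsControlled Ω q₀ q u ∧
    ∀ᵐ t ∂(volume.restrict (Ici (0 : ℝ))), IsMaxOn (fun v => inner ℝ (p t).2 v) Ω (u t)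

/-- The covector on the phase space given by `p = (φ, ψ)`: `(dx, dy) ↦ ⟨φ, dx⟩ + ⟨ψ, dy⟩`. -/
def covector (p : Phase) : Phase →L[ℝ] ℝ :=
  (innerSL ℝ p.1).comp (ContinuousLinearMap.fst ℝ Plane Plane) +
    (innerSL ℝ p.2).comp (ContinuousLinearMap.snd ℝ Plane Plane)

/-- The homogeneous gauge `max {√|x|, |y|}` of a point `(x, y)` of the phase space. -/
def gaugeQ (q : Phase) : ℝ := max (Real.sqrt ‖q.1‖) ‖q.2‖

/-- The homogeneous gauge `max {∛|φ|, ∜|ψ|}` of a pair `(φ, ψ)` of adjoint variables. -/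
def gaugeP (p : Phase) : ℝ := max (‖p.1‖ ^ (1 / 3 : ℝ)) (‖p.2‖ ^ (1 / 4 : ℝ))

end ModelProblem

end

open Set MeasureTheory
open scoped ENNReal

/-! Everything rests on the scaling `t ~ λ`, `y ~ λ`, `x ~ λ²`, `φ ~ λ³`, `ψ ~ λ⁴`, `B ~ λ⁵`. A
compact `Ω` with `0` in its interior is comparable with discs, so the scaling survives up to
constants. Two estimates carry it. A curve with bounded second derivative and initial gauge `g` has
`∫|x|² ≥ c g⁵` already on a time interval of length comparable to `g` (`gaugeQ_pow_le_integral`),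
and every point can be steered to the origin at cost at most `C g⁵` (`exists_steering`).

The parallelogram law makes a minimizing sequence Cauchy in energy. The first estimate, applied to
differences, turns this into pointwise convergence, which gives existence and, with zero error,
uniqueness of the optimal trajectory. Along it the remaining energy is comparable with `g⁵` and
drops by a fixed factor within time of order `g`. These times sum like a geometric series, so the
origin is reached in time of order `g` (`exists_extinction`).

Since motion stops, the adjoint function can be defined by zero data at the hitting time, and the
first variation of the convex functional gives the maximum principle. Conversely, at rest a
maximizing control satisfies `⟨ψ, u⟩ ≥ r|ψ|`, because `Ω` contains a disc of radius `r`, while the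
pairing identity makes `∫⟨ψ, u⟩` vanish; hence every adjoint function is zero there, and it is
unique.

For two extremals with differences `δq`, `δp`, the pairing satisfies `d/dt ⟨δp, δq⟩ = |δx|² + ⟨δψ,
δu⟩ ≥ |δx|²`, so `∫|δx|² ≤ -⟨δp(0), δq(0)⟩` (`IsAdjoint.integral_norm_sub_sq_le`). Bounding `δp(0)`
by the energy makes `E` locally Lipschitz. The interpolation estimate gives its injectivity, the
continuity of the flow and the lower gauge bound. Finally `-E` is a continuous selection of
subgradients of `B`, hence its derivative, and minimizing the coercive function `B + p` shows that
`E` takes every value `p`. -/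

namespace ModelProblem

/-! ### Calculus of integral solutions of `ḟ = g` on `[0, ∞)` -/

namespace SolvesDeriv

variable {f g f' g' : ℝ → Plane}

theorem intervalIntegrable (h : SolvesDeriv f g) {a b : ℝ} (ha : 0 ≤ a) (hb : 0 ≤ b) :
    IntervalIntegrable g volume a b :=
  (h a ha).1.symm.trans (h b hb).1

theorem sub_eq (h : SolvesDeriv f g) {a b : ℝ} (ha : 0 ≤ a) (hb : 0 ≤ b) :
    f b - f a = ∫ s in a..b, g s := by
  rw [(h a ha).2, (h b hb).2, ← intervalIntegral.integral_add_adjacent_intervals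
    (h a ha).1 (h.intervalIntegrable ha hb)]
  abel

theorem continuousOn (h : SolvesDeriv f g) : ContinuousOn f (Ici 0) := by
  have hIcc : ∀ b, 0 ≤ b → ContinuousOn f (Icc 0 b) := by
    intro b hb
    have h1 : ContinuousOn (fun t => f 0 + ∫ s in (0 : ℝ)..t, g s) (Icc 0 b) := by
      have := intervalIntegral.continuousOn_primitive_interval' (h b hb).1 left_mem_uIcc
      rw [uIcc_of_le hb] at this
      exact continuousOn_const.add this
    exact h1.congr fun t ht => (h t ht.1).2
  intro t ht
  have h1 : ContinuousWithinAt f (Icc 0 (t + 1)) t :=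
    hIcc (t + 1) (by linarith [mem_Ici.1 ht]) t ⟨ht, by linarith⟩
  refine h1.mono_of_mem_nhdsWithin ?_
  refine mem_nhdsWithin.2 ⟨Iio (t + 1), isOpen_Iio, by simp, ?_⟩
  rintro s ⟨hs, hs'⟩
  exact ⟨hs', le_of_lt hs⟩

theorem add (h : SolvesDeriv f g) (h' : SolvesDeriv f' g') :
    SolvesDeriv (fun t => f t + f' t) (fun t => g t + g' t) := by
  intro t ht
  refine ⟨(h t ht).1.add (h' t ht).1, ?_⟩
  beta_reduce
  rw [intervalIntegral.integral_add (h t ht).1 (h' t ht).1, (h t ht).2, (h' t ht).2]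
  abel

theorem const_smul (h : SolvesDeriv f g) (c : ℝ) :
    SolvesDeriv (fun t => c • f t) (fun t => c • g t) := by
  intro t ht
  refine ⟨(h t ht).1.smul c, ?_⟩
  beta_reduce
  rw [intervalIntegral.integral_smul, (h t ht).2, smul_add]

theorem sub (h : SolvesDeriv f g) (h' : SolvesDeriv f' g') :
    SolvesDeriv (fun t => f t - f' t) (fun t => g t - g' t) := by
  simpa [sub_eq_add_neg] using h.add (h'.const_smul (-1))

theorem congr (h : SolvesDeriv f g) (hf : EqOn f f' (Ici 0)) (hg : EqOn g g' (Ici 0)) :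
    SolvesDeriv f' g' := by
  intro t ht
  have h0 : EqOn g g' (uIcc 0 t) := by
    rw [uIcc_of_le ht]
    exact hg.mono fun s hs => hs.1
  refine ⟨(h t ht).1.congr (h0.mono uIoc_subset_uIcc), ?_⟩
  rw [← hf ht, ← hf (show (0 : ℝ) ∈ Ici 0 by simp), (h t ht).2, intervalIntegral.integral_congr h0]

theorem of_hasDerivAt (h : ∀ t, HasDerivAt f (g t) t) (hg : Continuous g) : SolvesDeriv f g := by
  intro t _
  refine ⟨hg.intervalIntegrable _ _, ?_⟩
  rw [intervalIntegral.integral_eq_sub_of_hasDerivAt (fun s _ => h s) (hg.intervalIntegrable _ _)]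
  abel

theorem shift (h : SolvesDeriv f g) {s : ℝ} (hs : 0 ≤ s) :
    SolvesDeriv (fun t => f (t + s)) (fun t => g (t + s)) := by
  intro t ht
  refine ⟨?_, ?_⟩
  · rw [IntervalIntegrable.comp_add_right_iff (by simp)]
    exact h.intervalIntegrable (by linarith) (by linarith)
  · rw [intervalIntegral.integral_comp_add_right, ← h.sub_eq (by linarith) (by linarith)]
    abel

theorem concat (h : SolvesDeriv f g) (h' : SolvesDeriv f' g') {s : ℝ} (hs : 0 ≤ s)
    (hfs : f' 0 = f s) :
    SolvesDeriv (fun t => if t ≤ s then f t else f' (t - s))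
      (fun t => if t ≤ s then g t else g' (t - s)) := by
  have h1 : ∀ t, 0 ≤ t → t ≤ s →
      EqOn g (fun t => if t ≤ s then g t else g' (t - s)) (uIcc 0 t) := by
    intro t ht hts r hr
    rw [uIcc_of_le ht] at hr
    simp [hr.2.trans hts]
  intro t ht
  by_cases hts : t ≤ s
  · refine ⟨(h t ht).1.congr ((h1 t ht hts).mono uIoc_subset_uIcc), ?_⟩
    rw [← intervalIntegral.integral_congr (h1 t ht hts)]
    simpa [hts, hs] using (h t ht).2
  · push Not at hts
    have h2 : EqOn (fun r => g' (r - s)) (fun t => if t ≤ s then g t else g' (t - s))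
        (uIoc s t) := by
      intro r hr
      rw [uIoc_of_le hts.le] at hr
      simp [not_le.2 hr.1]
    have i1 := (h s hs).1.congr ((h1 s hs le_rfl).mono uIoc_subset_uIcc)
    have i0 : IntervalIntegrable (fun r => g' (r - s)) volume s t := by
      have := (h' (t - s) (by linarith)).1.comp_sub_right s
      simpa using this
    have i2 := i0.congr h2
    refine ⟨i1.trans i2, ?_⟩
    rw [← intervalIntegral.integral_add_adjacent_intervals i1 i2,
      ← intervalIntegral.integral_congr (h1 s hs le_rfl),
      ← intervalIntegral.integral_congr_ae (Filter.Eventually.of_forall fun r hr => h2 hr),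
      intervalIntegral.integral_comp_sub_right, sub_self, ← add_assoc]
    simp only [hs, if_true, not_le.2 hts, if_false]
    rw [← (h s hs).2, ← hfs]
    exact (h' (t - s) (by linarith)).2

end SolvesDeriv

/-! ### Integration by parts and the pairing identity -/

theorem integral_mul_add_mul_primitive {f g f' g' : ℝ → ℝ} {S : ℝ} (hS : 0 ≤ S)
    (hf : ∀ t, 0 ≤ t → IntervalIntegrable f' volume 0 t ∧ f t = f 0 + ∫ s in (0 : ℝ)..t, f' s)
    (hg : ∀ t, 0 ≤ t → IntervalIntegrable g' volume 0 t ∧ g t = g 0 + ∫ s in (0 : ℝ)..t, g' s) :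
    ∫ t in (0 : ℝ)..S, (f' t * g t + f t * g' t) = f S * g S - f 0 * g 0 := by
  -- Nothing is known for negative times, so the product rule is applied to the primitives, which
  -- agree with `f` and `g` on `[0, ∞)`.
  set F : ℝ → ℝ := fun t => f 0 + ∫ s in (0 : ℝ)..t, f' s with hF
  set G : ℝ → ℝ := fun t => g 0 + ∫ s in (0 : ℝ)..t, g' s with hG
  have hconst : ∀ c : ℝ, AbsolutelyContinuousOnInterval (fun _ : ℝ => c) 0 S := fun c =>
    ((LipschitzWith.const c).lipschitzOnWith (s := uIcc 0 S)).absolutelyContinuousOnInterval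
  have aF : AbsolutelyContinuousOnInterval F 0 S := (hconst _).add
    ((hf S hS).1.absolutelyContinuousOnInterval_intervalIntegral left_mem_uIcc)
  have aG : AbsolutelyContinuousOnInterval G 0 S := (hconst _).add
    ((hg S hS).1.absolutelyContinuousOnInterval_intervalIntegral left_mem_uIcc)
  have key := aF.integral_deriv_mul_eq_sub aG
  have e : ∀ t, 0 ≤ t → f t = F t ∧ g t = G t := fun t ht => ⟨(hf t ht).2, (hg t ht).2⟩
  rw [(e S hS).1, (e S hS).2]
  have e0 : F 0 = f 0 ∧ G 0 = g 0 := by simp [hF, hG]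
  rw [← e0.1, ← e0.2, ← key]
  refine intervalIntegral.integral_congr_ae ?_
  filter_upwards [(hf S hS).1.ae_hasDerivAt_integral, (hg S hS).1.ae_hasDerivAt_integral]
    with t h1 h2 ht
  have ht' := uIoc_subset_uIcc ht
  rw [((h1 ht' 0 left_mem_uIcc).const_add (f 0)).deriv,
    ((h2 ht' 0 left_mem_uIcc).const_add (g 0)).deriv]
  rw [uIcc_of_le hS] at ht'
  rw [(e t ht'.1).1, (e t ht'.1).2]

theorem SolvesDeriv.coord {f g : ℝ → Plane} (h : SolvesDeriv f g) (i : Fin 2) (t : ℝ)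
    (ht : 0 ≤ t) : IntervalIntegrable (fun s => g s i) volume 0 t ∧
      f t i = f 0 i + ∫ s in (0 : ℝ)..t, g s i := by
  have h1 := (EuclideanSpace.proj i : Plane →L[ℝ] ℝ).intervalIntegral_comp_comm
    (h t ht).1
  have h2 := congrArg (EuclideanSpace.proj i : Plane →L[ℝ] ℝ) (h t ht).2
  refine ⟨?_, ?_⟩
  · have := (h t ht).1
    rw [intervalIntegrable_iff] at this ⊢
    exact (EuclideanSpace.proj i : Plane →L[ℝ] ℝ).integrable_comp this
  · rw [map_add, ← h1] at h2
    simpa using h2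

theorem SolvesDeriv.intervalIntegrable_inner_right {f g k : ℝ → Plane} (h : SolvesDeriv f g)
    (hk : ContinuousOn k (Ici 0)) {a b : ℝ} (ha : 0 ≤ a) (hb : 0 ≤ b) :
    IntervalIntegrable (fun t => inner ℝ (k t) (g t)) volume a b := by
  have hk' : ContinuousOn k (uIcc a b) := hk.mono fun t ht => (le_min ha hb).trans ht.1
  have : IntervalIntegrable (∑ i : Fin 2, fun t => k t i * g t i) volume a b := by
    refine IntervalIntegrable.sum _ fun i _ => ?_
    refine IntervalIntegrable.continuousOn_mul ?_ ?_
    · exact ((h.coord i a ha).1.symm).trans (h.coord i b hb).1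
    · exact (EuclideanSpace.proj i : Plane →L[ℝ] ℝ).continuous.comp_continuousOn
        hk'
  convert this using 2 with t
  simp [PiLp.inner_apply, mul_comm]

theorem SolvesDeriv.integral_inner {f g f' g' : ℝ → Plane} (hf : SolvesDeriv f f')
    (hg : SolvesDeriv g g') {S : ℝ} (hS : 0 ≤ S) :
    (∫ t in (0 : ℝ)..S, inner ℝ (g t) (f' t)) + ∫ t in (0 : ℝ)..S, inner ℝ (f t) (g' t) =
      inner ℝ (f S) (g S) - inner ℝ (f 0) (g 0) := by
  have hi : ∀ i : Fin 2, _ := fun i => integral_mul_add_mul_primitive hS (hf.coord i) (hg.coord i)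
  rw [← intervalIntegral.integral_add (hf.intervalIntegrable_inner_right hg.continuousOn le_rfl hS)
    (hg.intervalIntegrable_inner_right hf.continuousOn le_rfl hS)]
  have hc : ∀ {k : ℝ → Plane}, ContinuousOn k (Ici 0) → ∀ i, ContinuousOn (fun t => k t i)
      (uIcc 0 S) := by
    intro k hk i
    rw [uIcc_of_le hS]
    exact (EuclideanSpace.proj i : Plane →L[ℝ] ℝ).continuous.comp_continuousOn
        (hk.mono fun t ht => ht.1)
  have hint : ∀ i : Fin 2, IntervalIntegrable (fun t => f' t i * g t i + f t i * g' t i)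
      volume 0 S := fun i =>
    ((hf.coord i S hS).1.mul_continuousOn (hc hg.continuousOn i)).add
      ((hg.coord i S hS).1.continuousOn_mul (hc hf.continuousOn i))
  have e : (fun t => (inner ℝ (g t) (f' t) + inner ℝ (f t) (g' t) : ℝ)) =
      fun t => ∑ i, (f' t i * g t i + f t i * g' t i) := by
    ext t
    simp [PiLp.inner_apply]
    ring
  rw [e, intervalIntegral.integral_finsetSum fun i _ => hint i]
  simp only [hi]
  simp [PiLp.inner_apply]
  ring

/-- The derivative of the pairing of adjoint variables with a solution of `ẋ = y`, `ẏ = u`. -/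
theorem integral_pairing {φ ψ ξ x y u : ℝ → Plane} (hφ : SolvesDeriv φ ξ)
    (hψ : SolvesDeriv ψ (fun t => -φ t)) (hx : SolvesDeriv x y) (hy : SolvesDeriv y u)
    {S : ℝ} (hS : 0 ≤ S) :
    (∫ t in (0 : ℝ)..S, inner ℝ (x t) (ξ t)) + ∫ t in (0 : ℝ)..S, inner ℝ (ψ t) (u t) =
      (inner ℝ (φ S) (x S) + inner ℝ (ψ S) (y S)) -
        (inner ℝ (φ 0) (x 0) + inner ℝ (ψ 0) (y 0)) := by
  have h1 := hφ.integral_inner hx hS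
  have h2 := hψ.integral_inner hy hS
  -- The terms `⟨φ, y⟩` coming from `ẋ = y` and from `ψ̇ = -φ` cancel: the two systems are dual to
  -- each other.
  have h3 : ∫ t in (0 : ℝ)..S, inner ℝ (y t) (-φ t) = -∫ t in (0 : ℝ)..S, inner ℝ (φ t) (y t) := by
    rw [← intervalIntegral.integral_neg]
    exact intervalIntegral.integral_congr fun t _ => by
      simp [real_inner_comm]
  rw [h3] at h2
  linarith

/-! ### The homogeneous gauge -/

theorem gaugeQ_nonneg (q : Phase) : 0 ≤ gaugeQ q := le_max_of_le_left (Real.sqrt_nonneg _)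

theorem norm_fst_le_gaugeQ_sq (q : Phase) : ‖q.1‖ ≤ gaugeQ q ^ 2 := by
  rw [← Real.sqrt_le_left (gaugeQ_nonneg q)]
  exact le_max_left _ _

theorem norm_snd_le_gaugeQ (q : Phase) : ‖q.2‖ ≤ gaugeQ q := le_max_right _ _

theorem gaugeQ_eq_or (q : Phase) : ‖q.1‖ = gaugeQ q ^ 2 ∨ ‖q.2‖ = gaugeQ q := by
  rcases max_choice (Real.sqrt ‖q.1‖) ‖q.2‖ with h | h
  · left
    rw [gaugeQ, h, Real.sq_sqrt (norm_nonneg _)]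
  · right
    rw [gaugeQ, h]

theorem gaugeQ_zero : gaugeQ 0 = 0 := by simp [gaugeQ]

theorem gaugeQ_eq_zero {q : Phase} : gaugeQ q = 0 ↔ q = 0 := by
  refine ⟨fun h => ?_, fun h => by rw [h, gaugeQ_zero]⟩
  have h1 := norm_fst_le_gaugeQ_sq q
  have h2 := norm_snd_le_gaugeQ q
  rw [h] at h1 h2
  exact Prod.ext (norm_le_zero_iff.1 (by simpa using h1)) (norm_le_zero_iff.1 h2)

theorem continuous_gaugeQ : Continuous gaugeQ := by
  unfold gaugeQ
  fun_prop

/-! ### The interpolation inequality between energy and gauge -/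

theorem SolvesDeriv.norm_sub_le {f g : ℝ → Plane} {K : ℝ} (h : SolvesDeriv f g)
    (hg : ∀ᵐ t ∂(volume.restrict (Ici (0 : ℝ))), ‖g t‖ ≤ K) {a b : ℝ} (ha : 0 ≤ a) (hab : a ≤ b) :
    ‖f b - f a‖ ≤ K * (b - a) := by
  rw [h.sub_eq ha (ha.trans hab), ← abs_of_nonneg (sub_nonneg.2 hab)]
  refine intervalIntegral.norm_integral_le_of_norm_le_const_ae ?_
  rw [ae_restrict_iff' measurableSet_Ici] at hg
  filter_upwards [hg] with t ht h't
  rw [uIoc_of_le hab] at h't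
  exact ht (ha.trans h't.1.le)

theorem norm_sub_affine_le {x y u : ℝ → Plane} {K : ℝ} (hx : SolvesDeriv x y)
    (hy : SolvesDeriv y u) (hu : ∀ᵐ t ∂(volume.restrict (Ici (0 : ℝ))), ‖u t‖ ≤ K) (hK : 0 ≤ K)
    {t : ℝ} (ht : 0 ≤ t) : ‖x t - (x 0 + t • y 0)‖ ≤ K * t ^ 2 := by
  have h1 : x t - (x 0 + t • y 0) = ∫ s in (0 : ℝ)..t, (y s - y 0) := by
    rw [intervalIntegral.integral_sub (hx t ht).1 (by simp), (hx t ht).2]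
    simp
  have h2 : ‖∫ s in (0 : ℝ)..t, (y s - y 0)‖ ≤ K * t * |t - 0| := by
    refine intervalIntegral.norm_integral_le_of_norm_le_const fun s hs => ?_
    rw [uIoc_of_le ht] at hs
    refine (hy.norm_sub_le hu le_rfl hs.1.le).trans ?_
    have := hs.2
    gcongr
    linarith
  rw [h1]
  refine h2.trans (le_of_eq ?_)
  rw [sub_zero, abs_of_nonneg ht]
  ring

/-- A curve with bounded second derivative whose initial point has a large gauge has large energy
on a short interval. -/
theorem gaugeQ_pow_le_integral {x y u : ℝ → Plane} {K : ℝ} (hx : SolvesDeriv x y)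
    (hy : SolvesDeriv y u) (hu : ∀ᵐ t ∂(volume.restrict (Ici (0 : ℝ))), ‖u t‖ ≤ K) (hK : 1 ≤ K) :
    (1 / (4 * K)) ^ 3 / 48 * gaugeQ (x 0, y 0) ^ 5 ≤
      ∫ t in (0 : ℝ)..1 / (4 * K) * gaugeQ (x 0, y 0), ‖x t‖ ^ 2 := by
  set g := gaugeQ (x 0, y 0) with hg
  have hg0 : 0 ≤ g := gaugeQ_nonneg _
  have hKpos : 0 < K := by linarith
  -- On this time scale the deviation `K t²` from affine motion is at most `g δ / 4`, small enough
  -- for the affine part to dominate in the mean square.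
  set δ := 1 / (4 * K) * g with hδ
  have hδ0 : 0 ≤ δ := by positivity
  have hKδ : K * δ = g / 4 := by rw [hδ]; field_simp
  have hδg : δ ≤ g / 4 := by nlinarith
  have hxc : ContinuousOn (fun t => ‖x t‖ ^ 2) (uIcc 0 δ) := by
    rw [uIcc_of_le hδ0]
    exact (hx.continuousOn.mono fun t ht => ht.1).norm.pow 2
  set A := ‖x 0‖
  set B := ‖y 0‖
  set I : ℝ := inner ℝ (x 0) (y 0) with hI
  have hIAB : |I| ≤ A * B := abs_real_inner_le_norm _ _
  -- This is `|a|² ≤ 2|x|² + 2|x - a|²` for the affine part `a` of `x`.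
  have hpt : ∀ t ∈ Icc 0 δ,
      1 / 2 * (A ^ 2 + 2 * t * I + t ^ 2 * B ^ 2) - K ^ 2 * t ^ 4 ≤ ‖x t‖ ^ 2 := by
    intro t ht
    have h1 := norm_sub_affine_le hx hy hu hKpos.le ht.1
    have h2 : ‖x 0 + t • y 0‖ ^ 2 = A ^ 2 + 2 * t * I + t ^ 2 * B ^ 2 := by
      rw [norm_add_sq_real, real_inner_smul_right, norm_smul, Real.norm_eq_abs, mul_pow, sq_abs]
      ring
    have h3 : ‖x 0 + t • y 0‖ ≤ ‖x t‖ + ‖x t - (x 0 + t • y 0)‖ := by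
      have := norm_sub_norm_le (x 0 + t • y 0) (x t)
      rw [norm_sub_rev] at this
      linarith
    have h4 : ‖x t - (x 0 + t • y 0)‖ ^ 2 ≤ K ^ 2 * t ^ 4 := by
      calc _ ≤ (K * t ^ 2) ^ 2 := by gcongr
        _ = _ := by ring
    have h5 : ‖x 0 + t • y 0‖ ^ 2 ≤ (‖x t‖ + ‖x t - (x 0 + t • y 0)‖) ^ 2 := by gcongr
    nlinarith [sq_nonneg (‖x t‖ - ‖x t - (x 0 + t • y 0)‖)]
  have hcont : Continuous fun t : ℝ =>
      1 / 2 * (A ^ 2 + 2 * t * I + t ^ 2 * B ^ 2) - K ^ 2 * t ^ 4 := by fun_prop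
  have hmono := intervalIntegral.integral_mono_on (μ := volume) hδ0 (hcont.intervalIntegrable 0 δ)
    hxc.intervalIntegrable hpt
  have hd : ∀ t : ℝ, HasDerivAt (fun t : ℝ =>
      1 / 2 * (A ^ 2 * t + t ^ 2 * I + t ^ 3 / 3 * B ^ 2) - K ^ 2 * (t ^ 5 / 5))
      (1 / 2 * (A ^ 2 + 2 * t * I + t ^ 2 * B ^ 2) - K ^ 2 * t ^ 4) t := by
    intro t
    have h1 := (hasDerivAt_id' t).const_mul (A ^ 2)
    have h2 := (hasDerivAt_pow 2 t).mul_const I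
    have h3 := ((hasDerivAt_pow 3 t).div_const 3).mul_const (B ^ 2)
    have h5 := ((hasDerivAt_pow 5 t).div_const 5).const_mul (K ^ 2)
    refine ((((h1.add h2).add h3).const_mul (1 / 2)).sub h5).congr_deriv ?_
    push_cast
    ring
  rw [intervalIntegral.integral_eq_sub_of_hasDerivAt (fun t _ => hd t)
    (hcont.intervalIntegrable 0 δ)] at hmono
  refine le_trans ?_ hmono
  have e1 : (1 / (4 * K)) ^ 3 / 48 * g ^ 5 = δ ^ 3 * g ^ 2 / 48 := by rw [hδ]; ring
  have e2 : K ^ 2 * (δ ^ 5 / 5) = δ ^ 3 * g ^ 2 / 80 := by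
    calc K ^ 2 * (δ ^ 5 / 5) = (K * δ) ^ 2 * δ ^ 3 / 5 := by ring
      _ = _ := by rw [hKδ]; ring
  rw [e1, e2]
  have hA : 0 ≤ A := norm_nonneg _
  have hB : 0 ≤ B := norm_nonneg _
  have hI' : -(A * B) ≤ I := (abs_le.1 hIAB).1
  have e3 : -(δ ^ 2 * (A * B)) ≤ δ ^ 2 * I := by nlinarith [sq_nonneg δ]
  -- Half of this bound minus the error `1/80` still exceeds `1/48`.
  suffices h : δ ^ 3 * g ^ 2 / 12 ≤ A ^ 2 * δ + δ ^ 2 * I + δ ^ 3 / 3 * B ^ 2 by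
    have : 0 ≤ δ ^ 3 * g ^ 2 := by positivity
    norm_num
    linarith
  -- The form `δA² - δ²AB + δ³B²/3` is positive definite. Completing the square leaves `δA²/4` when
  -- `A = g²` and `δ³B²/12` when `B = g`.
  rcases gaugeQ_eq_or (x 0, y 0) with h | h
  · have hA2 : A = g ^ 2 := h
    have e4 : 0 ≤ δ * (δ * B / 2 - A * 3 / 4) ^ 2 := by positivity
    have e5 : δ * δ ^ 2 * g ^ 2 ≤ δ * (g / 4) ^ 2 * g ^ 2 := by gcongr
    rw [hA2] at e3 e4 ⊢
    nlinarith [e3, e4, e5, mul_nonneg hδ0 (pow_nonneg hg0 4)]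
  · have hB2 : B = g := h
    have e4 : 0 ≤ δ * (δ * B / 2 - A) ^ 2 := by positivity
    rw [hB2] at e3 e4 ⊢
    nlinarith [e3, e4]

/-! ### Energy after a given time -/

/-- The energy `∫ |x|²` after time `s`. -/
noncomputable def tailEnergy (q : ℝ → Phase) (s : ℝ) : ℝ≥0∞ :=
  ∫⁻ t in Ici s, ENNReal.ofReal (‖(q t).1‖ ^ 2)

theorem cost_eq (q : ℝ → Phase) : cost q = 2⁻¹ * tailEnergy q 0 := by
  simp [cost, tailEnergy]

theorem cost_le_cost_iff {q q' : ℝ → Phase} :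
    cost q ≤ cost q' ↔ tailEnergy q 0 ≤ tailEnergy q' 0 := by
  rw [cost_eq, cost_eq]
  exact ENNReal.mul_le_mul_iff_right (by simp) (by simp)

theorem tailEnergy_shift (q : ℝ → Phase) (a s : ℝ) :
    tailEnergy (fun t => q (t + s)) a = tailEnergy q (a + s) := by
  have h := (measurePreserving_add_right volume s).setLIntegral_comp_preimage_emb
    (MeasurableEquiv.addRight s).measurableEmbedding
    (fun t => ENNReal.ofReal (‖(q t).1‖ ^ 2)) (Ici (a + s))
  simpa [tailEnergy] using h

theorem tailEnergy_congr {q q' : ℝ → Phase} {s : ℝ} (h : EqOn q q' (Ici s)) :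
    tailEnergy q s = tailEnergy q' s :=
  setLIntegral_congr_fun measurableSet_Ici fun t ht => by simp only [h ht]

theorem tailEnergy_anti (q : ℝ → Phase) : Antitone (tailEnergy q) := fun _ _ h =>
  lintegral_mono_set (Ici_subset_Ici.2 h)

theorem tailEnergy_eq_add {q : ℝ → Phase} (hq : ContinuousOn (fun t => (q t).1) (Ici 0)) {a b : ℝ}
    (ha : 0 ≤ a) (hab : a ≤ b) :
    tailEnergy q a = ENNReal.ofReal (∫ t in a..b, ‖(q t).1‖ ^ 2) + tailEnergy q b := by
  have hc : ContinuousOn (fun t => ‖(q t).1‖ ^ 2) (Icc a b) :=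
    (hq.mono fun t ht => ha.trans ht.1).norm.pow 2
  rw [intervalIntegral.integral_of_le hab, ← integral_Ico_eq_integral_Ioc,
    ofReal_integral_eq_lintegral_ofReal (hc.integrableOn_Icc.mono_set Ico_subset_Icc_self)
      (Filter.Eventually.of_forall fun t => by positivity),
    tailEnergy, tailEnergy, ← lintegral_union measurableSet_Ici, Ico_union_Ici_eq_Ici hab]
  exact Set.disjoint_left.2 fun t ht ht' => not_le.2 ht.2 ht'

theorem tailEnergy_eq_zero_of_forall {q : ℝ → Phase} {s : ℝ} (h : ∀ t, s ≤ t → q t = 0) :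
    tailEnergy q s = 0 := by
  rw [tailEnergy_congr (q' := fun _ => 0) h]
  simp [tailEnergy]

theorem ofReal_gaugeQ_pow_le_tailEnergy {q : ℝ → Phase} {u : ℝ → Plane} {K : ℝ}
    (hx : SolvesDeriv (fun t => (q t).1) (fun t => (q t).2))
    (hy : SolvesDeriv (fun t => (q t).2) u)
    (hu : ∀ᵐ t ∂(volume.restrict (Ici (0 : ℝ))), ‖u t‖ ≤ K) (hK : 1 ≤ K) :
    ENNReal.ofReal ((1 / (4 * K)) ^ 3 / 48 * gaugeQ (q 0) ^ 5) ≤ tailEnergy q 0 := by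
  have h0 : 0 ≤ 1 / (4 * K) * gaugeQ (q 0) := mul_nonneg (by positivity) (gaugeQ_nonneg _)
  have key := gaugeQ_pow_le_integral hx hy hu hK
  simp only [Prod.mk.eta] at key
  rw [tailEnergy_eq_add hx.continuousOn le_rfl h0]
  exact le_add_right (ENNReal.ofReal_le_ofReal key)

/-! ### Operations on controlled trajectories -/

namespace IsControlled

variable {Ω : Set Plane} {q₀ q₀' : Phase} {q q' : ℝ → Phase} {u u' : ℝ → Plane}

theorem norm_le (h : IsControlled Ω q₀ q u) {K : ℝ} (hK : ∀ v ∈ Ω, ‖v‖ ≤ K) :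
    ∀ᵐ t ∂(volume.restrict (Ici (0 : ℝ))), ‖u t‖ ≤ K :=
  h.mem.mono fun _ ht => hK _ ht

theorem shift (h : IsControlled Ω q₀ q u) {s : ℝ} (hs : 0 ≤ s) :
    IsControlled Ω (q s) (fun t => q (t + s)) (fun t => u (t + s)) where
  init := by simp
  deriv_x := h.deriv_x.shift hs
  deriv_y := h.deriv_y.shift hs
  mem := by
    have h1 := h.mem
    rw [ae_restrict_iff' measurableSet_Ici] at h1 ⊢
    filter_upwards [(measurePreserving_add_right volume s).quasiMeasurePreserving.ae h1]
      with t ht h't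
    exact ht (add_nonneg h't hs)

theorem concat (h : IsControlled Ω q₀ q u) {s : ℝ} (hs : 0 ≤ s)
    (h' : IsControlled Ω (q s) q' u') :
    IsControlled Ω q₀ (fun t => if t ≤ s then q t else q' (t - s))
      (fun t => if t ≤ s then u t else u' (t - s)) where
  init := by simp [hs, h.init]
  deriv_x := by
    simpa only [apply_ite Prod.fst, apply_ite Prod.snd] using
      h.deriv_x.concat h'.deriv_x hs (by rw [h'.init])
  deriv_y := by
    simpa only [apply_ite Prod.snd] using h.deriv_y.concat h'.deriv_y hs (by rw [h'.init])
  mem := by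
    have h1 := h.mem
    have h2 := h'.mem
    rw [ae_restrict_iff' measurableSet_Ici] at h1 h2 ⊢
    filter_upwards [h1, (measurePreserving_sub_right volume s).quasiMeasurePreserving.ae h2]
      with t ht ht' h0
    by_cases hts : t ≤ s
    · simpa [hts] using ht h0
    · simpa [hts] using ht' (sub_nonneg.2 (not_le.1 hts).le)

theorem combo (hconv : Convex ℝ Ω) (h : IsControlled Ω q₀ q u) (h' : IsControlled Ω q₀' q' u')
    {a b : ℝ} (ha : 0 ≤ a) (hb : 0 ≤ b) (hab : a + b = 1) :
    IsControlled Ω (a • q₀ + b • q₀') (fun t => a • q t + b • q' t)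
      (fun t => a • u t + b • u' t) where
  init := by rw [h.init, h'.init]
  deriv_x := (h.deriv_x.const_smul a).add (h'.deriv_x.const_smul b)
  deriv_y := (h.deriv_y.const_smul a).add (h'.deriv_y.const_smul b)
  mem := by
    filter_upwards [h.mem, h'.mem] with t ht ht'
    exact hconv ht ht' ha hb hab

theorem zero (hzero : (0 : Plane) ∈ Ω) : IsControlled Ω 0 (fun _ => 0) (fun _ => 0) where
  init := rfl
  deriv_x := fun t _ => by simp
  deriv_y := fun t _ => by simp
  mem := by simp [hzero]

theorem continuousOn (h : IsControlled Ω q₀ q u) : ContinuousOn q (Ici 0) :=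
  h.deriv_x.continuousOn.prodMk h.deriv_y.continuousOn

/-- Interpolation: the distance of two controlled trajectories at a given time is bounded by
their distance in energy after that time. -/
theorem ofReal_gaugeQ_sub_pow_le (h : IsControlled Ω q₀ q u) (h' : IsControlled Ω q₀' q' u')
    {K : ℝ} (hK1 : 1 ≤ K) (hK : ∀ v ∈ Ω, ‖v‖ ≤ K) {t : ℝ} (ht : 0 ≤ t) :
    ENNReal.ofReal ((1 / (4 * (2 * K))) ^ 3 / 48 * gaugeQ (q t - q' t) ^ 5) ≤
      tailEnergy (fun s => q s - q' s) t := by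
  have hx := (h.shift ht).deriv_x.sub (h'.shift ht).deriv_x
  have hy := (h.shift ht).deriv_y.sub (h'.shift ht).deriv_y
  -- The interpolation inequality needs only a bound on the second derivative, so the difference of
  -- two trajectories is covered with `2K` in place of `K`.
  have hu : ∀ᵐ s ∂(volume.restrict (Ici (0 : ℝ))), ‖u (s + t) - u' (s + t)‖ ≤ 2 * K := by
    filter_upwards [(h.shift ht).norm_le hK, (h'.shift ht).norm_le hK] with s hs hs'
    linarith [norm_sub_le (u (s + t)) (u' (s + t))]
  have := ofReal_gaugeQ_pow_le_tailEnergy (q := fun s => q (s + t) - q' (s + t)) hx hy hu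
    (by linarith)
  simpa only [tailEnergy_shift (fun s => q s - q' s) 0 t, zero_add] using this

end IsControlled

/-! ### Steering to the origin -/

theorem exists_forall_norm_le {Ω : Set Plane} (hcomp : IsCompact Ω) :
    ∃ K : ℝ, 1 ≤ K ∧ ∀ v ∈ Ω, ‖v‖ ≤ K := by
  obtain ⟨C, hC⟩ := hcomp.isBounded.exists_norm_le
  exact ⟨max 1 C, le_max_left _ _, fun v hv => (hC v hv).trans (le_max_right _ _)⟩

theorem exists_closedBall_subset {Ω : Set Plane} (hzero : (0 : Plane) ∈ interior Ω) :
    ∃ r : ℝ, 0 < r ∧ ∀ v : Plane, ‖v‖ ≤ r → v ∈ Ω := by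
  obtain ⟨r, hr, h⟩ := Metric.nhds_basis_closedBall.mem_iff.1 (mem_interior_iff_mem_nhds.1 hzero)
  exact ⟨r, hr, fun v hv => h (by simpa using hv)⟩

/-- Every point can be steered to the origin, in a time and at a cost controlled by its gauge. -/
theorem exists_steering {Ω : Set Plane} (hzero : (0 : Plane) ∈ interior Ω) :
    ∃ M C : ℝ, 0 < M ∧ 0 < C ∧ ∀ q₀ : Phase, ∃ q u, IsControlled Ω q₀ q u ∧
      (∀ t, M * gaugeQ q₀ ≤ t → q t = 0) ∧
      tailEnergy q 0 ≤ ENNReal.ofReal (C * gaugeQ q₀ ^ 5) := by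
  obtain ⟨r, hr, hball⟩ := exists_closedBall_subset hzero
  have h0Ω : (0 : Plane) ∈ Ω := interior_subset hzero
  -- `28 = 6 + 4 + 12 + 6` sums the absolute values of the coefficients in `a` and `b` below.
  set M := max 1 (28 / r) with hM
  have hM1 : 1 ≤ M := le_max_left _ _
  have hM0 : 0 < M := by linarith
  have hMr : 28 / M ≤ r := by
    rw [div_le_iff₀ hM0]
    have : 28 / r ≤ M := le_max_right _ _
    rw [div_le_iff₀ hr] at this
    linarith
  refine ⟨M, M * (1 + M + M ^ 2 * r) ^ 2, hM0, by positivity, fun q₀ => ?_⟩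
  -- At the origin the steering time `τ` would be zero, and `a`, `b` divide by it.
  by_cases hq0 : q₀ = 0
  · subst hq0
    refine ⟨_, _, IsControlled.zero h0Ω, fun _ _ => rfl, ?_⟩
    rw [tailEnergy_eq_zero_of_forall fun _ _ => rfl]
    exact zero_le
  obtain ⟨x₀, y₀⟩ := q₀
  set g := gaugeQ (x₀, y₀) with hg
  have hg0 : 0 < g := lt_of_le_of_ne (gaugeQ_nonneg _) fun h => hq0 (gaugeQ_eq_zero.1 h.symm)
  have hxg : ‖x₀‖ ≤ g ^ 2 := norm_fst_le_gaugeQ_sq (x₀, y₀)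
  have hyg : ‖y₀‖ ≤ g := norm_snd_le_gaugeQ (x₀, y₀)
  set τ := M * g with hτ
  have hτ0 : 0 < τ := by positivity
  -- `a + t b` is the only affine control that brings `(x₀, y₀)` to the origin at time `τ`.
  set a : Plane := (-6 / τ ^ 2) • x₀ + (-4 / τ) • y₀ with ha
  set b : Plane := (12 / τ ^ 3) • x₀ + (6 / τ ^ 2) • y₀ with hb
  have hab : ‖a‖ + τ * ‖b‖ ≤ r := by
    have h1 : ‖a‖ ≤ 6 / τ ^ 2 * ‖x₀‖ + 4 / τ * ‖y₀‖ := by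
      refine (norm_add_le _ _).trans (le_of_eq ?_)
      rw [norm_smul, norm_smul, Real.norm_eq_abs, Real.norm_eq_abs, abs_div, abs_div,
        abs_of_pos hτ0, abs_of_pos (pow_pos hτ0 2)]
      norm_num
    have h2 : ‖b‖ ≤ 12 / τ ^ 3 * ‖x₀‖ + 6 / τ ^ 2 * ‖y₀‖ := by
      refine (norm_add_le _ _).trans (le_of_eq ?_)
      rw [norm_smul, norm_smul, Real.norm_eq_abs, Real.norm_eq_abs, abs_div, abs_div,
        abs_of_pos (pow_pos hτ0 2), abs_of_pos (pow_pos hτ0 3)]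
      norm_num
    calc ‖a‖ + τ * ‖b‖
        ≤ (6 / τ ^ 2 * ‖x₀‖ + 4 / τ * ‖y₀‖) +
          τ * (12 / τ ^ 3 * ‖x₀‖ + 6 / τ ^ 2 * ‖y₀‖) := by gcongr
      _ = 18 / τ ^ 2 * ‖x₀‖ + 10 / τ * ‖y₀‖ := by field_simp; ring
      _ ≤ 18 / τ ^ 2 * g ^ 2 + 10 / τ * g := by gcongr
      _ = 18 / M ^ 2 + 10 / M := by rw [hτ]; field_simp
      _ ≤ 18 / M + 10 / M := by
        gcongr
        nlinarith
      _ = 28 / M := by ring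
      _ ≤ r := hMr
  set x : ℝ → Plane := fun t => x₀ + t • y₀ + (t ^ 2 / 2) • a + (t ^ 3 / 6) • b with hx
  set y : ℝ → Plane := fun t => y₀ + t • a + (t ^ 2 / 2) • b with hy
  set v : ℝ → Plane := fun t => a + t • b with hv
  have dx : SolvesDeriv x y := by
    refine SolvesDeriv.of_hasDerivAt (fun t => ?_) (by fun_prop)
    have h1 := (hasDerivAt_id' t).smul_const y₀
    have h2 := ((hasDerivAt_pow 2 t).div_const 2).smul_const a
    have h3 := ((hasDerivAt_pow 3 t).div_const 6).smul_const b
    refine (((h1.const_add x₀).add h2).add h3).congr_deriv ?_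
    simp only [hy]
    congr 1
    · congr 1
      · simp
      · congr 1
        norm_num
    · congr 1
      norm_num
      ring
  have dy : SolvesDeriv y v := by
    refine SolvesDeriv.of_hasDerivAt (fun t => ?_) (by fun_prop)
    have h1 := (hasDerivAt_id' t).smul_const a
    have h2 := ((hasDerivAt_pow 2 t).div_const 2).smul_const b
    refine ((h1.const_add y₀).add h2).congr_deriv ?_
    simp only [hv]
    congr 1
    · simp
    · congr 1
      norm_num
  have xτ : x τ = 0 := by
    simp only [hx, ha, hb]
    match_scalars <;> (field_simp; ring)
  have yτ : y τ = 0 := by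
    simp only [hy, ha, hb]
    match_scalars <;> (field_simp; ring)
  have hz := IsControlled.zero h0Ω
  set q : ℝ → Phase := fun t => if t ≤ τ then (x t, y t) else 0 with hq
  have hctrl : IsControlled Ω (x₀, y₀) q (fun t => if t ≤ τ then v t else 0) := by
    refine ⟨?_, ?_, ?_, ?_⟩
    · simp [hq, hτ0.le, hx, hy]
    · simpa only [hq, apply_ite Prod.fst, apply_ite Prod.snd] using
        dx.concat hz.deriv_x hτ0.le (by simp [xτ])
    · simpa only [hq, apply_ite Prod.snd] using dy.concat hz.deriv_y hτ0.le (by simp [yτ])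
    · rw [ae_restrict_iff' measurableSet_Ici]
      refine Filter.Eventually.of_forall fun t ht => ?_
      by_cases htτ : t ≤ τ
      · simp only [htτ, if_true]
        refine hball _ ((norm_add_le _ _).trans (le_trans ?_ hab))
        rw [norm_smul, Real.norm_eq_abs, abs_of_nonneg ht]
        gcongr
      · simpa [htτ] using h0Ω
  have hq_zero : ∀ t, τ ≤ t → q t = 0 := by
    intro t ht
    rcases ht.eq_or_lt with rfl | h
    · simp [hq, xτ, yτ]
    · simp [hq, not_le.2 h]
  refine ⟨q, _, hctrl, hq_zero, ?_⟩
  rw [tailEnergy_eq_add hctrl.deriv_x.continuousOn le_rfl hτ0.le,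
    tailEnergy_eq_zero_of_forall hq_zero, add_zero]
  refine ENNReal.ofReal_le_ofReal ?_
  -- Position stays of order `g²` during a time of order `g`, whence the fifth power.
  have hbd : ∀ t ∈ uIoc 0 τ, ‖‖(q t).1‖ ^ 2‖ ≤ ((1 + M + M ^ 2 * r) * g ^ 2) ^ 2 := by
    intro t ht
    rw [uIoc_of_le hτ0.le] at ht
    have ht0 := ht.1.le
    have htτ := ht.2
    rw [Real.norm_of_nonneg (by positivity)]
    gcongr
    simp only [hq, htτ, if_true, hx]
    have e : x₀ + t • y₀ + (t ^ 2 / 2) • a + (t ^ 3 / 6) • b =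
      x₀ + t • y₀ + t ^ 2 • ((1 / 2 : ℝ) • a + (t / 6) • b) := by module
    rw [e]
    have e2 : ‖(1 / 2 : ℝ) • a + (t / 6) • b‖ ≤ r := by
      refine (norm_add_le _ _).trans (le_trans ?_ hab)
      rw [norm_smul, norm_smul, Real.norm_of_nonneg (by positivity),
        Real.norm_of_nonneg (by positivity)]
      have : t / 6 ≤ τ := by linarith
      have := norm_nonneg a
      gcongr
      linarith
    calc ‖x₀ + t • y₀ + t ^ 2 • ((1 / 2 : ℝ) • a + (t / 6) • b)‖
        ≤ ‖x₀‖ + t * ‖y₀‖ + t ^ 2 * ‖(1 / 2 : ℝ) • a + (t / 6) • b‖ := by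
          refine (norm_add₃_le).trans (le_of_eq ?_)
          rw [norm_smul, norm_smul, Real.norm_of_nonneg ht0, Real.norm_of_nonneg (by positivity)]
      _ ≤ g ^ 2 + τ * g + τ ^ 2 * r := by gcongr
      _ = (1 + M + M ^ 2 * r) * g ^ 2 := by rw [hτ]; ring
  have := intervalIntegral.norm_integral_le_of_norm_le_const hbd
  refine (le_abs_self _).trans (this.trans (le_of_eq ?_))
  rw [sub_zero, abs_of_pos hτ0, hτ]
  ring

/-! ### Existence and uniqueness of optimal trajectories -/

open Filter Topology

theorem aemeasurable_norm_sq {x : ℝ → Plane} (hx : ContinuousOn x (Ici 0)) :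
    AEMeasurable (fun t => ENNReal.ofReal (‖x t‖ ^ 2)) (volume.restrict (Ici 0)) :=
  ((hx.norm.pow 2).aemeasurable measurableSet_Ici).ennreal_ofReal

theorem tailEnergy_parallelogram {q q' : ℝ → Phase} (hq : ContinuousOn (fun t => (q t).1) (Ici 0))
    (hq' : ContinuousOn (fun t => (q' t).1) (Ici 0)) :
    tailEnergy (fun t => q t - q' t) 0 +
        4 * tailEnergy (fun t => (1 / 2 : ℝ) • q t + (1 / 2 : ℝ) • q' t) 0 =
      2 * tailEnergy q 0 + 2 * tailEnergy q' 0 := by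
  have m1 := aemeasurable_norm_sq (hq.sub hq')
  have m2 := aemeasurable_norm_sq hq
  simp only [tailEnergy]
  rw [← lintegral_const_mul' 4 _ (by simp), ← lintegral_const_mul' 2 _ (by simp),
    ← lintegral_const_mul' 2 _ (by simp), ← lintegral_add_left' (by exact m1),
    ← lintegral_add_left' (m2.const_mul 2)]
  refine lintegral_congr fun t => ?_
  have e2 : ∀ a : ℝ, 2 * ENNReal.ofReal a = ENNReal.ofReal (2 * a) := fun a => by
    rw [ENNReal.ofReal_mul (by norm_num), ENNReal.ofReal_ofNat]
  have e4 : ∀ a : ℝ, 4 * ENNReal.ofReal a = ENNReal.ofReal (4 * a) := fun a => by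
    rw [ENNReal.ofReal_mul (by norm_num), ENNReal.ofReal_ofNat]
  rw [e2, e2, e4, ← ENNReal.ofReal_add (by positivity) (by positivity),
    ← ENNReal.ofReal_add (by positivity) (by positivity)]
  congr 1
  have h := parallelogram_law_with_norm ℝ (q t).1 (q' t).1
  have h2 : ‖((1 / 2 : ℝ) • q t + (1 / 2 : ℝ) • q' t).1‖ = 1 / 2 * ‖(q t).1 + (q' t).1‖ := by
    rw [Prod.fst_add, Prod.smul_fst, Prod.smul_fst, ← smul_add, norm_smul]
    norm_num
  rw [h2, Prod.fst_sub]
  nlinarith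

/-- Subtracting from `f` the primitive of its almost everywhere derivative leaves a Lipschitz
function with zero derivative almost everywhere, hence a constant. -/
theorem SolvesDeriv.of_lipschitzWith {f : ℝ → Plane} {K : NNReal} (hf : LipschitzWith K f) :
    SolvesDeriv f (deriv f) := by
  have hint : ∀ a b : ℝ, IntervalIntegrable (deriv f) volume a b := by
    intro a b
    refine (intervalIntegrable_const (c := (K : ℝ))).mono_fun
      (stronglyMeasurable_deriv f).aestronglyMeasurable (Eventually.of_forall fun t => ?_)
    simpa using norm_deriv_le_of_lipschitz hf
  intro t ht
  refine ⟨hint 0 t, ?_⟩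
  have hlip : LipschitzWith K fun t => ∫ s in (0 : ℝ)..t, deriv f s := by
    refine LipschitzWith.of_dist_le_mul fun a b => ?_
    rw [dist_eq_norm, intervalIntegral.integral_interval_sub_left (hint _ _) (hint _ _),
      Real.dist_eq]
    exact intervalIntegral.norm_integral_le_of_norm_le_const fun s _ =>
      norm_deriv_le_of_lipschitz hf
  have hac := (hf.sub hlip).lipschitzOnWith (s := uIcc 0 t) |>.absolutelyContinuousOnInterval
  obtain ⟨C, hC⟩ := hac.const_of_ae_hasDerivAt_zero (by
    filter_upwards [hf.ae_differentiableAt_real, (hint 0 t).ae_hasDerivAt_integral] with s h1 h2 hs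
    exact (h1.hasDerivAt.sub (h2 hs 0 left_mem_uIcc)).congr_deriv (sub_self _))
  have h0 := hC 0 left_mem_uIcc
  have h1 := hC t right_mem_uIcc
  rw [← h0] at h1
  simp only [intervalIntegral.integral_same, sub_zero] at h1
  rw [← h1]
  abel

/-- A slope of `y` is an average of the control, and a closed convex set contains averages. In this
form the control constraint survives pointwise limits. -/
theorem IsControlled.slope_mem {Ω : Set Plane} {q₀ : Phase} {q : ℝ → Phase} {u : ℝ → Plane}
    (h : IsControlled Ω q₀ q u) (hconv : Convex ℝ Ω) (hclosed : IsClosed Ω) {a b : ℝ}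
    (ha : 0 ≤ a) (hab : a < b) : (b - a)⁻¹ • ((q b).2 - (q a).2) ∈ Ω := by
  have hint := h.deriv_y.intervalIntegrable ha (ha.trans hab.le)
  rw [intervalIntegrable_iff_integrableOn_Ioc_of_le hab.le] at hint
  have hmem : ∀ᵐ t ∂(volume.restrict (Ioc a b)), u t ∈ Ω :=
    ae_restrict_of_ae_restrict_of_subset (fun t ht => ha.trans ht.1.le) h.mem
  have := hconv.set_average_mem hclosed (by simp [hab]) (by simp) hmem hint
  rw [setAverage_eq, ← intervalIntegral.integral_of_le hab.le,
    ← h.deriv_y.sub_eq ha (ha.trans hab.le)] at this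
  simpa [measureReal_def, hab.le] using this

/-- Pointwise limits of trajectories with a common initial point are trajectories. -/
theorem exists_isControlled_of_tendsto {Ω : Set Plane} (hconv : Convex ℝ Ω) (hcomp : IsCompact Ω)
    {q₀ : Phase} {Q : ℕ → ℝ → Phase} {U : ℕ → ℝ → Plane}
    (hQ : ∀ n, IsControlled Ω q₀ (Q n) (U n)) {q : ℝ → Phase}
    (hlim : ∀ t, 0 ≤ t → Tendsto (fun n => Q n t) atTop (𝓝 (q t))) :
    ∃ u, IsControlled Ω q₀ q u := by
  obtain ⟨K, hK1, hK⟩ := exists_forall_norm_le hcomp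
  have hK0 : 0 ≤ K := by linarith
  have hlim2 : ∀ t, 0 ≤ t → Tendsto (fun n => (Q n t).2) atTop (𝓝 (q t).2) := fun t ht =>
    (continuous_snd.tendsto _).comp (hlim t ht)
  have hlim1 : ∀ t, 0 ≤ t → Tendsto (fun n => (Q n t).1) atTop (𝓝 (q t).1) := fun t ht =>
    (continuous_fst.tendsto _).comp (hlim t ht)
  have hinit : q 0 = q₀ := by
    refine tendsto_nhds_unique (hlim 0 le_rfl) ?_
    simp [(hQ _).init]
  have hslope : ∀ a b, 0 ≤ a → a < b → (b - a)⁻¹ • ((q b).2 - (q a).2) ∈ Ω := by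
    intro a b ha hab
    refine hcomp.isClosed.mem_of_tendsto
      (((hlim2 b (ha.trans hab.le)).sub (hlim2 a ha)).const_smul (b - a)⁻¹)
      (Eventually.of_forall fun n => (hQ n).slope_mem hconv hcomp.isClosed ha hab)
  have hbd : ∀ a b, 0 ≤ a → a ≤ b → ‖(q b).2 - (q a).2‖ ≤ K * (b - a) := by
    intro a b ha hab
    refine le_of_tendsto (((hlim2 b (ha.trans hab)).sub (hlim2 a ha)).norm)
      (Eventually.of_forall fun n => (hQ n).deriv_y.norm_sub_le ((hQ n).norm_le hK) ha hab)
  -- Freezing `y` at negative times makes it Lipschitz on the whole line; the control is then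
  -- recovered as `deriv y`.
  set y : ℝ → Plane := fun t => (q (max t 0)).2 with hy
  have hylip : LipschitzWith ⟨K, hK0⟩ y := by
    refine LipschitzWith.of_dist_le_mul fun a b => ?_
    wlog hab : a ≤ b generalizing a b
    · rw [dist_comm, dist_comm a]
      exact this b a (le_of_not_ge hab)
    have h1 := hbd (max a 0) (max b 0) (le_max_right _ _) (max_le_max_right 0 hab)
    have h2 : max b 0 - max a 0 ≤ b - a := by
      rcases max_cases b 0 with h | h <;> rcases max_cases a 0 with h' | h' <;> linarith
    rw [dist_comm, dist_comm a, dist_eq_norm, Real.dist_eq, abs_of_nonneg (by linarith)]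
    refine h1.trans ?_
    change K * _ ≤ K * _
    gcongr
  have hyq : EqOn y (fun t => (q t).2) (Ici 0) := fun t ht => by
    simp [hy, max_eq_left (mem_Ici.1 ht)]
  refine ⟨deriv y, hinit, ?_, (SolvesDeriv.of_lipschitzWith hylip).congr hyq fun _ _ => rfl, ?_⟩
  · have hx : SolvesDeriv (fun t => (q t).1) y := by
      intro t ht
      refine ⟨hylip.continuous.intervalIntegrable _ _, ?_⟩
      refine tendsto_nhds_unique (hlim1 t ht) ?_
      have h1 : Tendsto (fun n => ∫ s in (0 : ℝ)..t, (Q n s).2) atTop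
          (𝓝 (∫ s in (0 : ℝ)..t, y s)) := by
        refine intervalIntegral.tendsto_integral_filter_of_dominated_convergence
          (fun _ => ‖q₀.2‖ + K * t) ?_ ?_ (by simp) ?_
        · refine Eventually.of_forall fun n => ?_
          exact (intervalIntegrable_iff.1 ((hQ n).deriv_x t ht).1).aestronglyMeasurable
        · refine Eventually.of_forall fun n => Eventually.of_forall fun s hs => ?_
          rw [uIoc_of_le ht] at hs
          have h2 := (hQ n).deriv_y.norm_sub_le ((hQ n).norm_le hK) le_rfl hs.1.le
          have h3 := norm_sub_norm_le (Q n s).2 (Q n 0).2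
          rw [(hQ n).init] at h2 h3
          have h4 : K * (s - 0) ≤ K * t := by
            have := hs.2
            gcongr
            linarith
          linarith
        · refine Eventually.of_forall fun s hs => ?_
          rw [uIoc_of_le ht] at hs
          rw [hyq hs.1.le]
          exact hlim2 s hs.1.le
      refine ((hlim1 0 le_rfl).add h1).congr fun n => ?_
      exact ((hQ n).deriv_x t ht).2.symm
    exact hx.congr (fun _ _ => rfl) hyq
  · rw [ae_restrict_iff' measurableSet_Ici]
    filter_upwards [hylip.ae_differentiableAt_real] with t ht h0
    -- Right slopes suffice, and they involve nonnegative times only.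
    have h1 : Tendsto (slope y t) (𝓝[>] t) (𝓝 (deriv y t)) :=
      (hasDerivAt_iff_tendsto_slope.1 ht.hasDerivAt).mono_left
        (nhdsWithin_mono _ fun s hs => ne_of_gt hs)
    refine hcomp.isClosed.mem_of_tendsto h1 ?_
    filter_upwards [self_mem_nhdsWithin] with s hs
    rw [slope_def_module, hyq h0, hyq (show s ∈ Ici 0 from (mem_Ici.1 h0).trans (le_of_lt hs))]
    exact hslope t s h0 hs

theorem norm_le_gaugeQ_sq_add (q : Phase) : ‖q‖ ≤ gaugeQ q ^ 2 + gaugeQ q := by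
  have h1 := norm_fst_le_gaugeQ_sq q
  have h2 := norm_snd_le_gaugeQ q
  have h3 := gaugeQ_nonneg q
  exact norm_prod_le_iff.2 ⟨by linarith, by nlinarith⟩

theorem tailEnergy_le_liminf {Q : ℕ → ℝ → Phase} {q : ℝ → Phase}
    (hQ : ∀ n, ContinuousOn (Q n) (Ici 0))
    (hlim : ∀ t, 0 ≤ t → Tendsto (fun n => Q n t) atTop (𝓝 (q t))) :
    tailEnergy q 0 ≤ liminf (fun n => tailEnergy (Q n) 0) atTop := by
  refine le_trans (le_of_eq ?_) (lintegral_liminf_le' fun n =>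
    aemeasurable_norm_sq (continuous_fst.comp_continuousOn (hQ n)))
  refine setLIntegral_congr_fun measurableSet_Ici fun t ht => ?_
  have : Tendsto (fun n => ENNReal.ofReal (‖(Q n t).1‖ ^ 2)) atTop
      (𝓝 (ENNReal.ofReal (‖(q t).1‖ ^ 2))) :=
    ENNReal.tendsto_ofReal ((((continuous_fst.tendsto _).comp (hlim t ht)).norm).pow 2)
  exact this.liminf_eq.symm

theorem isOptimal_iff {Ω : Set Plane} {q₀ : Phase} {q : ℝ → Phase} :
    IsOptimal Ω q₀ q ↔ IsAdmissible Ω q₀ q ∧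
      ∀ q', IsAdmissible Ω q₀ q' → tailEnergy q 0 ≤ tailEnergy q' 0 := by
  simp only [IsOptimal, cost_le_cost_iff]

theorem IsAdmissible.continuousOn {Ω : Set Plane} {q₀ : Phase} {q : ℝ → Phase}
    (h : IsAdmissible Ω q₀ q) : ContinuousOn q (Ici 0) :=
  h.choose_spec.continuousOn

theorem IsAdmissible.midpoint {Ω : Set Plane} (hconv : Convex ℝ Ω) {q₀ : Phase}
    {q q' : ℝ → Phase} (h : IsAdmissible Ω q₀ q) (h' : IsAdmissible Ω q₀ q') :
    IsAdmissible Ω q₀ (fun t => (1 / 2 : ℝ) • q t + (1 / 2 : ℝ) • q' t) := by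
  obtain ⟨u, hu⟩ := h
  obtain ⟨u', hu'⟩ := h'
  have := hu.combo hconv hu' (a := 1 / 2) (b := 1 / 2) (by norm_num) (by norm_num) (by norm_num)
  rw [← add_smul, add_halves, one_smul] at this
  exact ⟨_, this⟩

/-- The midpoint of two admissible trajectories is admissible, so its energy is at least `V`; the
parallelogram identity turns this into closeness of near-minimizers. -/
theorem tailEnergy_sub_le {Ω : Set Plane} (hconv : Convex ℝ Ω) {q₀ : Phase}
    {q q' : ℝ → Phase} (h : IsAdmissible Ω q₀ q) (h' : IsAdmissible Ω q₀ q') {V a a' : ℝ≥0∞}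
    (hV : V ≠ ∞) (hVle : ∀ p, IsAdmissible Ω q₀ p → V ≤ tailEnergy p 0)
    (hq : tailEnergy q 0 ≤ V + a) (hq' : tailEnergy q' 0 ≤ V + a') :
    tailEnergy (fun t => q t - q' t) 0 ≤ 2 * a + 2 * a' := by
  have h1 := tailEnergy_parallelogram (continuous_fst.comp_continuousOn h.continuousOn)
    (continuous_fst.comp_continuousOn h'.continuousOn)
  have h2 := hVle _ (h.midpoint hconv h')
  have h3 : tailEnergy (fun t => q t - q' t) 0 + 4 * V ≤ (2 * a + 2 * a') + 4 * V := by
    calc tailEnergy (fun t => q t - q' t) 0 + 4 * V ≤ _ := by gcongr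
      _ = _ := h1
      _ ≤ 2 * (V + a) + 2 * (V + a') := by gcongr
      _ = (2 * a + 2 * a') + 4 * V := by ring
  exact (ENNReal.add_le_add_iff_right (ENNReal.mul_ne_top (by simp) hV)).1 h3

/-- The direct method without weak compactness: a minimizing sequence is Cauchy in energy, hence
pointwise by interpolation. Its limit is admissible, and Fatou's lemma gives optimality. -/
theorem exists_isOptimal {Ω : Set Plane} (hconv : Convex ℝ Ω) (hcomp : IsCompact Ω)
    (hzero : (0 : Plane) ∈ interior Ω) (q₀ : Phase) : ∃ q, IsOptimal Ω q₀ q := by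
  obtain ⟨K, hK1, hK⟩ := exists_forall_norm_le hcomp
  obtain ⟨M, C, -, -, hsteer⟩ := exists_steering hzero
  set V : ℝ≥0∞ := ⨅ (q : ℝ → Phase) (_ : IsAdmissible Ω q₀ q), tailEnergy q 0 with hVdef
  have hVle : ∀ p, IsAdmissible Ω q₀ p → V ≤ tailEnergy p 0 := fun p hp => iInf₂_le p hp
  have hV : V ≠ ∞ := by
    obtain ⟨q, u, hq, -, hE⟩ := hsteer q₀
    exact ((hVle q ⟨u, hq⟩).trans_lt (hE.trans_lt ENNReal.ofReal_lt_top)).ne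
  have hseq : ∀ n : ℕ, ∃ q, IsAdmissible Ω q₀ q ∧
      tailEnergy q 0 ≤ V + ENNReal.ofReal (1 / (n + 1)) := by
    intro n
    have h1 : V < V + ENNReal.ofReal (1 / (n + 1)) :=
      ENNReal.lt_add_right hV (by simp; positivity)
    obtain ⟨q, hq⟩ := iInf_lt_iff.1 h1
    obtain ⟨hq, h2⟩ := iInf_lt_iff.1 hq
    exact ⟨q, hq, h2.le⟩
  choose Q hQ hQE using hseq
  choose U hU using hQ
  set c : ℝ := (1 / (4 * (2 * K))) ^ 3 / 48 with hc
  have hc0 : 0 < c := by positivity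
  -- The energy gap `4 / (N + 1)` of two late members, converted into a gauge by the inverse of `c
  -- g⁵`.
  set β : ℕ → ℝ := fun N => (4 / (N + 1) / c) ^ (1 / 5 : ℝ) with hβ
  have hβlim : Tendsto β atTop (𝓝 0) := by
    have h1 : Tendsto (fun N : ℕ => 4 / ((N : ℝ) + 1) / c) atTop (𝓝 0) := by
      have := (tendsto_one_div_add_atTop_nhds_zero_nat (𝕜 := ℝ)).const_mul (4 / c)
      rw [mul_zero] at this
      refine this.congr fun N => ?_
      field_simp
    have := h1.rpow_const (p := 1 / 5) (Or.inr (by norm_num))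
    rwa [Real.zero_rpow (by norm_num)] at this
  have hgauge : ∀ t, 0 ≤ t → ∀ n m N : ℕ, N ≤ n → N ≤ m → gaugeQ (Q n t - Q m t) ≤ β N := by
    intro t ht n m N hn hm
    have h1 := (hU n).ofReal_gaugeQ_sub_pow_le (hU m) hK1 hK ht
    have h2 := tailEnergy_sub_le hconv ⟨_, hU n⟩ ⟨_, hU m⟩ hV hVle (hQE n) (hQE m)
    have h3 := h1.trans ((tailEnergy_anti _ ht).trans h2)
    have hN : ∀ k : ℕ, N ≤ k → ENNReal.ofReal (1 / (k + 1)) ≤ ENNReal.ofReal (1 / (N + 1)) := by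
      intro k hk
      have : (N : ℝ) ≤ k := by exact_mod_cast hk
      gcongr
    have h4 : ENNReal.ofReal (c * gaugeQ (Q n t - Q m t) ^ 5) ≤ ENNReal.ofReal (4 / (N + 1)) := by
      calc _ ≤ _ := h3
        _ ≤ 2 * ENNReal.ofReal (1 / (N + 1)) + 2 * ENNReal.ofReal (1 / (N + 1)) := by
          gcongr 2 * ?_ + 2 * ?_
          · exact hN n hn
          · exact hN m hm
        _ = 4 * ENNReal.ofReal (1 / (N + 1)) := by ring
        _ = ENNReal.ofReal 4 * ENNReal.ofReal (1 / (N + 1)) := by simp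
        _ = ENNReal.ofReal (4 / (N + 1)) := by
          rw [← ENNReal.ofReal_mul (by norm_num)]
          congr 1
          ring
    have h5 := (ENNReal.ofReal_le_ofReal_iff (by positivity)).1 h4
    have h6 : gaugeQ (Q n t - Q m t) ^ 5 ≤ 4 / (N + 1) / c := by
      rw [le_div_iff₀ hc0]
      linarith
    calc gaugeQ (Q n t - Q m t) = (gaugeQ (Q n t - Q m t) ^ (5 : ℕ)) ^ (1 / 5 : ℝ) := by
          rw [← Real.rpow_natCast, ← Real.rpow_mul (gaugeQ_nonneg _)]
          norm_num
      _ ≤ β N := Real.rpow_le_rpow (pow_nonneg (gaugeQ_nonneg _) _) h6 (by norm_num)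
  have hlim : ∀ t, ∃ l, 0 ≤ t → Tendsto (fun n => Q n t) atTop (𝓝 l) := by
    intro t
    by_cases ht : 0 ≤ t
    · have : CauchySeq fun n => Q n t := by
        refine cauchySeq_of_le_tendsto_0 (fun N => β N ^ 2 + β N) (fun n m N hn hm => ?_) ?_
        · have h1 := hgauge t ht n m N hn hm
          have h2 := gaugeQ_nonneg (Q n t - Q m t)
          rw [dist_eq_norm]
          refine (norm_le_gaugeQ_sq_add _).trans ?_
          gcongr
        · simpa using (hβlim.pow 2).add hβlim
      obtain ⟨l, hl⟩ := cauchySeq_tendsto_of_complete this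
      exact ⟨l, fun _ => hl⟩
    · exact ⟨0, fun h => absurd h ht⟩
  choose q hq using hlim
  refine ⟨q, isOptimal_iff.2 ⟨exists_isControlled_of_tendsto hconv hcomp hU hq, fun q' hq' => ?_⟩⟩
  refine le_trans ?_ (hVle q' hq')
  refine (tailEnergy_le_liminf (fun n => (hU n).continuousOn) hq).trans ?_
  have h1 : Tendsto (fun n : ℕ => V + ENNReal.ofReal (1 / ((n : ℝ) + 1))) atTop (𝓝 V) := by
    have := ENNReal.tendsto_ofReal (tendsto_one_div_add_atTop_nhds_zero_nat (𝕜 := ℝ))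
    simpa using this.const_add V
  rw [← h1.liminf_eq]
  exact liminf_le_liminf (Eventually.of_forall hQE)

theorem IsOptimal.tailEnergy_ne_top {Ω : Set Plane} (hzero : (0 : Plane) ∈ interior Ω)
    {q₀ : Phase} {q : ℝ → Phase} (h : IsOptimal Ω q₀ q) : tailEnergy q 0 ≠ ∞ := by
  obtain ⟨M, C, -, -, hsteer⟩ := exists_steering hzero
  obtain ⟨q', u, hq, -, hE⟩ := hsteer q₀
  exact (((isOptimal_iff.1 h).2 q' ⟨u, hq⟩).trans_lt (hE.trans_lt ENNReal.ofReal_lt_top)).ne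

/-- With zero errors the near-minimizer estimate gives zero energy of the difference, and
interpolation makes the difference vanish at each time. -/
theorem IsOptimal.eqOn {Ω : Set Plane} (hconv : Convex ℝ Ω) (hcomp : IsCompact Ω)
    (hzero : (0 : Plane) ∈ interior Ω) {q₀ : Phase} {q q' : ℝ → Phase} (h : IsOptimal Ω q₀ q)
    (h' : IsOptimal Ω q₀ q') : EqOn q q' (Ici 0) := by
  obtain ⟨K, hK1, hK⟩ := exists_forall_norm_le hcomp
  have hV := h.tailEnergy_ne_top hzero
  rw [isOptimal_iff] at h h'
  intro t ht
  have h1 := tailEnergy_sub_le hconv h.1 h'.1 (a := 0) (a' := 0) hV h.2 (by simp)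
    (by simpa using h'.2 q h.1)
  obtain ⟨⟨u, hu⟩, -⟩ := h
  obtain ⟨⟨u', hu'⟩, -⟩ := h'
  have h2 := hu.ofReal_gaugeQ_sub_pow_le hu' hK1 hK ht
  have h3 := h2.trans ((tailEnergy_anti _ ht).trans h1)
  have hc0 : 0 < (1 / (4 * (2 * K))) ^ 3 / 48 := by positivity
  have h4 : gaugeQ (q t - q' t) ^ 5 ≤ 0 := by
    simp only [mul_zero, add_zero, nonpos_iff_eq_zero, ENNReal.ofReal_eq_zero] at h3
    nlinarith
  have h5 : gaugeQ (q t - q' t) = 0 :=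
    pow_eq_zero_iff (by norm_num) |>.1 (le_antisymm h4 (pow_nonneg (gaugeQ_nonneg _) _))
  exact sub_eq_zero.1 (gaugeQ_eq_zero.1 h5)

/-- The dynamic programming principle. -/
theorem IsOptimal.shift {Ω : Set Plane} (hzero : (0 : Plane) ∈ interior Ω) {q₀ : Phase}
    {q : ℝ → Phase} (h : IsOptimal Ω q₀ q) {s : ℝ} (hs : 0 ≤ s) :
    IsOptimal Ω (q s) (fun t => q (t + s)) := by
  have hV := h.tailEnergy_ne_top hzero
  rw [isOptimal_iff] at h ⊢
  obtain ⟨⟨u, hu⟩, hmin⟩ := h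
  refine ⟨⟨_, hu.shift hs⟩, ?_⟩
  rintro q' ⟨u', hu'⟩
  have hc := hu.concat hs hu'
  have h1 := hmin _ ⟨_, hc⟩
  rw [tailEnergy_eq_add hc.deriv_x.continuousOn le_rfl hs] at h1
  rw [tailEnergy_eq_add hu.deriv_x.continuousOn le_rfl hs] at h1 hV
  have e1 : ∫ t in (0 : ℝ)..s, ‖(if t ≤ s then q t else q' (t - s)).1‖ ^ 2 =
      ∫ t in (0 : ℝ)..s, ‖(q t).1‖ ^ 2 := by
    refine intervalIntegral.integral_congr fun t ht => ?_
    rw [uIcc_of_le hs] at ht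
    simp [ht.2]
  have e2 : tailEnergy (fun t => if t ≤ s then q t else q' (t - s)) s = tailEnergy q' 0 := by
    have e3 := tailEnergy_shift q' s (-s)
    rw [add_neg_cancel] at e3
    rw [← e3]
    refine tailEnergy_congr fun t ht => ?_
    rcases (mem_Ici.1 ht).eq_or_lt with rfl | hlt
    · simp [hu'.init]
    · simp [not_le.2 hlt, sub_eq_add_neg]
  rw [e1, e2] at h1
  rw [tailEnergy_shift, zero_add]
  exact (ENNReal.add_le_add_iff_left ENNReal.ofReal_ne_top).1 h1

/-! ### Finite-time extinction and the hitting time -/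

/-- Finite time extinction for a nonincreasing function that decays by a fixed factor on
time intervals comparable to its fifth root. -/
theorem eq_zero_of_decay {b : ℝ → ℝ} {k θ : ℝ} (hk : 0 ≤ k) (hθ0 : 0 ≤ θ) (hθ1 : θ < 1)
    (hb0 : ∀ t, 0 ≤ t → 0 ≤ b t) (hanti : ∀ s t, 0 ≤ s → s ≤ t → b t ≤ b s)
    (hdecay : ∀ t, 0 ≤ t → b (t + k * b t ^ (1 / 5 : ℝ)) ≤ θ * b t) :
    b (k / (1 - θ ^ (1 / 5 : ℝ)) * b 0 ^ (1 / 5 : ℝ)) = 0 := by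
  set ρ := θ ^ (1 / 5 : ℝ) with hρ
  have hρ0 : 0 ≤ ρ := Real.rpow_nonneg hθ0 _
  have hρ1 : ρ < 1 := Real.rpow_lt_one hθ0 hθ1 (by norm_num)
  -- The sum `k(1 + ρ + ρ² + …)` of the waiting times, used through `L = k + ρL`.
  set L := k / (1 - ρ) with hL
  have hL0 : 0 ≤ L := div_nonneg hk (by linarith)
  have hLk : L = k + ρ * L := by
    rw [hL]
    field_simp [sub_ne_zero.2 hρ1.ne']
    ring
  -- The time budget is the same for every number `n` of decay steps: one step spends `k` and leaves
  -- at least `L` in the units of the new state.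
  have key : ∀ n : ℕ, ∀ t, 0 ≤ t → b (t + L * b t ^ (1 / 5 : ℝ)) ≤ θ ^ n * b t := by
    intro n
    induction n with
    | zero =>
      intro t ht
      have : 0 ≤ b t ^ (1 / 5 : ℝ) := Real.rpow_nonneg (hb0 t ht) _
      simpa using hanti t _ ht (le_add_of_nonneg_right (mul_nonneg hL0 this))
    | succ n ih =>
      intro t ht
      have hz : 0 ≤ b t ^ (1 / 5 : ℝ) := Real.rpow_nonneg (hb0 t ht) _
      set t' := t + k * b t ^ (1 / 5 : ℝ) with ht'
      have ht'0 : 0 ≤ t' := add_nonneg ht (mul_nonneg hk hz)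
      have h1 : b t' ≤ θ * b t := hdecay t ht
      have h2 : b t' ^ (1 / 5 : ℝ) ≤ ρ * b t ^ (1 / 5 : ℝ) := by
        rw [hρ, ← Real.mul_rpow hθ0 (hb0 t ht)]
        exact Real.rpow_le_rpow (hb0 _ ht'0) h1 (by norm_num)
      have h3 : t' + L * b t' ^ (1 / 5 : ℝ) ≤ t + L * b t ^ (1 / 5 : ℝ) := by
        have h4 : L * b t' ^ (1 / 5 : ℝ) ≤ L * (ρ * b t ^ (1 / 5 : ℝ)) := by gcongr
        have h5 : L * b t ^ (1 / 5 : ℝ) = (k + ρ * L) * b t ^ (1 / 5 : ℝ) := by rw [← hLk]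
        rw [ht', h5]
        linarith
      have h6 : 0 ≤ t' + L * b t' ^ (1 / 5 : ℝ) :=
        add_nonneg ht'0 (mul_nonneg hL0 (Real.rpow_nonneg (hb0 _ ht'0) _))
      calc b (t + L * b t ^ (1 / 5 : ℝ)) ≤ b (t' + L * b t' ^ (1 / 5 : ℝ)) := hanti _ _ h6 h3
        _ ≤ θ ^ n * b t' := ih t' ht'0
        _ ≤ θ ^ n * (θ * b t) := by gcongr
        _ = θ ^ (n + 1) * b t := by ring
  have hz : 0 ≤ b 0 ^ (1 / 5 : ℝ) := Real.rpow_nonneg (hb0 0 le_rfl) _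
  have hlim : Tendsto (fun n : ℕ => θ ^ n * b 0) atTop (𝓝 0) := by
    simpa using (tendsto_pow_atTop_nhds_zero_of_lt_one hθ0 hθ1).mul_const (b 0)
  refine le_antisymm (ge_of_tendsto hlim (Eventually.of_forall fun n => ?_))
    (hb0 _ (mul_nonneg hL0 hz))
  simpa using key n 0 le_rfl

/-- Two-sided bound of the minimal energy by the gauge, together with the energy dissipation. -/
theorem exists_energy_bounds {Ω : Set Plane} (hcomp : IsCompact Ω)
    (hzero : (0 : Plane) ∈ interior Ω) : ∃ ε c C : ℝ, 0 < ε ∧ 0 < c ∧ 0 < C ∧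
      ∀ (q₀ : Phase) (q : ℝ → Phase), IsOptimal Ω q₀ q → ∀ t, 0 ≤ t →
        c * gaugeQ (q t) ^ 5 ≤ (tailEnergy q t).toReal ∧
        (tailEnergy q t).toReal ≤ C * gaugeQ (q t) ^ 5 ∧
        c * gaugeQ (q t) ^ 5 + (tailEnergy q (t + ε * gaugeQ (q t))).toReal ≤
          (tailEnergy q t).toReal := by
  obtain ⟨K, hK1, hK⟩ := exists_forall_norm_le hcomp
  obtain ⟨M, C, -, hC, hsteer⟩ := exists_steering hzero
  refine ⟨1 / (4 * K), (1 / (4 * K)) ^ 3 / 48, C, by positivity, by positivity, hC, ?_⟩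
  intro q₀ q h t ht
  have ho := h.shift hzero ht
  have hV := ho.tailEnergy_ne_top hzero
  obtain ⟨⟨u, hu⟩, hmin⟩ := isOptimal_iff.1 ho
  have hg : 0 ≤ 1 / (4 * K) * gaugeQ (q t) := mul_nonneg (by positivity) (gaugeQ_nonneg _)
  have h2 : tailEnergy q t ≤ ENNReal.ofReal (C * gaugeQ (q t) ^ 5) := by
    obtain ⟨q', u', hq', -, hE⟩ := hsteer (q t)
    have := (hmin q' ⟨u', hq'⟩).trans hE
    rwa [tailEnergy_shift, zero_add] at this
  have key := gaugeQ_pow_le_integral hu.deriv_x hu.deriv_y (hu.norm_le hK) hK1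
  simp only [zero_add, Prod.mk.eta] at key
  have h3 := tailEnergy_eq_add hu.deriv_x.continuousOn le_rfl hg
  have e : tailEnergy (fun s => q (s + t)) (1 / (4 * K) * gaugeQ (q t)) =
      tailEnergy q (t + 1 / (4 * K) * gaugeQ (q t)) := by
    rw [tailEnergy_shift, add_comm]
  rw [e, tailEnergy_shift, zero_add] at h3
  rw [tailEnergy_shift, zero_add] at hV
  have hV' : tailEnergy q (t + 1 / (4 * K) * gaugeQ (q t)) ≠ ∞ :=
    ne_top_of_le_ne_top hV (tailEnergy_anti q (by linarith))
  have h4 : (tailEnergy q t).toReal =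
      (∫ s in (0 : ℝ)..1 / (4 * K) * gaugeQ (q t), ‖(q (s + t)).1‖ ^ 2) +
        (tailEnergy q (t + 1 / (4 * K) * gaugeQ (q t))).toReal := by
    rw [h3, ENNReal.toReal_add ENNReal.ofReal_ne_top hV', ENNReal.toReal_ofReal]
    exact intervalIntegral.integral_nonneg hg fun s _ => by positivity
  have h5 : 0 ≤ (tailEnergy q (t + 1 / (4 * K) * gaugeQ (q t))).toReal := ENNReal.toReal_nonneg
  refine ⟨by linarith, ?_, by linarith⟩
  exact ENNReal.toReal_le_of_le_ofReal
    (mul_nonneg hC.le (pow_nonneg (gaugeQ_nonneg _) _)) h2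

theorem IsOptimal.toReal_tailEnergy_anti {Ω : Set Plane} (hzero : (0 : Plane) ∈ interior Ω)
    {q₀ : Phase} {q : ℝ → Phase} (h : IsOptimal Ω q₀ q) {s t : ℝ} (hs : 0 ≤ s) (hst : s ≤ t) :
    (tailEnergy q t).toReal ≤ (tailEnergy q s).toReal :=
  ENNReal.toReal_mono
    (ne_top_of_le_ne_top (h.tailEnergy_ne_top hzero) (tailEnergy_anti q hs))
    (tailEnergy_anti q hst)

theorem rpow_fifth_of_pow {a : ℝ} (ha : 0 ≤ a) : (a ^ 5) ^ (1 / 5 : ℝ) = a := by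
  rw [← Real.rpow_natCast, ← Real.rpow_mul ha]
  norm_num

/-- Optimal trajectories reach the origin in finite time and stay there. -/
theorem exists_extinction {Ω : Set Plane} (hcomp : IsCompact Ω)
    (hzero : (0 : Plane) ∈ interior Ω) : ∃ C : ℝ, 0 < C ∧
      ∀ (q₀ : Phase) (q : ℝ → Phase), IsOptimal Ω q₀ q → ∀ t, C * gaugeQ q₀ ≤ t → q t = 0 := by
  obtain ⟨ε, c, C, hε, hc, hC, hE⟩ := exists_energy_bounds hcomp hzero
  -- If `b'` is the energy after time `εg`, then `b' ≤ b - c g⁵` and `b' ≤ C g⁵`; adding `C` times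
  -- the first to `c` times the second gives `(C + c) b' ≤ C b`.
  set θ := C / (C + c) with hθ
  have hθ0 : 0 ≤ θ := by positivity
  have hθ1 : θ < 1 := by
    rw [hθ, div_lt_one (by positivity)]
    linarith
  set k := ε * (1 / c) ^ (1 / 5 : ℝ) with hk
  have hk0 : 0 < k := by positivity
  have hρ1 : θ ^ (1 / 5 : ℝ) < 1 := Real.rpow_lt_one hθ0 hθ1 (by norm_num)
  have hL : 0 < k / (1 - θ ^ (1 / 5 : ℝ)) := div_pos hk0 (by linarith)
  refine ⟨k / (1 - θ ^ (1 / 5 : ℝ)) * C ^ (1 / 5 : ℝ), by positivity, ?_⟩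
  intro q₀ q h t ht
  have hq0 : q 0 = q₀ := h.1.choose_spec.init
  have hg0 : 0 ≤ gaugeQ q₀ := gaugeQ_nonneg _
  set b : ℝ → ℝ := fun t => (tailEnergy q t).toReal with hb
  have hanti : ∀ s t, 0 ≤ s → s ≤ t → b t ≤ b s := fun s t hs hst =>
    h.toReal_tailEnergy_anti hzero hs hst
  have hdecay : ∀ t, 0 ≤ t → b (t + k * b t ^ (1 / 5 : ℝ)) ≤ θ * b t := by
    intro t ht
    obtain ⟨h1, h2, h3⟩ := hE q₀ q h t ht
    have hg := gaugeQ_nonneg (q t)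
    have h4 : gaugeQ (q t) ≤ (1 / c) ^ (1 / 5 : ℝ) * b t ^ (1 / 5 : ℝ) := by
      rw [← Real.mul_rpow (by positivity) ENNReal.toReal_nonneg]
      calc gaugeQ (q t) = (gaugeQ (q t) ^ 5) ^ (1 / 5 : ℝ) := (rpow_fifth_of_pow hg).symm
        _ ≤ _ := by
          refine Real.rpow_le_rpow (by positivity) ?_ (by norm_num)
          rw [one_div, ← div_eq_inv_mul, le_div_iff₀ hc]
          linarith
    have h5 : b (t + k * b t ^ (1 / 5 : ℝ)) ≤ b (t + ε * gaugeQ (q t)) := by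
      refine hanti _ _ (by positivity) ?_
      have : ε * gaugeQ (q t) ≤ ε * ((1 / c) ^ (1 / 5 : ℝ) * b t ^ (1 / 5 : ℝ)) := by gcongr
      rw [hk]
      linarith
    refine h5.trans ?_
    rw [hθ, div_mul_eq_mul_div, le_div_iff₀ (by positivity)]
    have h6 : 0 ≤ b (t + ε * gaugeQ (q t)) := ENNReal.toReal_nonneg
    change c * gaugeQ (q t) ^ 5 + b (t + ε * gaugeQ (q t)) ≤ b t at h3
    change b t ≤ C * gaugeQ (q t) ^ 5 at h2
    have h7 : 0 ≤ c * gaugeQ (q t) ^ 5 := by positivity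
    have h8 := mul_le_mul_of_nonneg_left h3 hC.le
    have h9 : c * b (t + ε * gaugeQ (q t)) ≤ c * (C * gaugeQ (q t) ^ 5) := by
      gcongr
      linarith
    linarith
  have h0 := eq_zero_of_decay hk0.le hθ0 hθ1 (fun _ _ => ENNReal.toReal_nonneg) hanti hdecay
  have hb0 : b 0 ^ (1 / 5 : ℝ) ≤ C ^ (1 / 5 : ℝ) * gaugeQ q₀ := by
    have h2 := (hE q₀ q h 0 le_rfl).2.1
    rw [hq0] at h2
    calc b 0 ^ (1 / 5 : ℝ) ≤ (C * gaugeQ q₀ ^ 5) ^ (1 / 5 : ℝ) :=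
          Real.rpow_le_rpow ENNReal.toReal_nonneg h2 (by norm_num)
      _ = _ := by rw [Real.mul_rpow hC.le (by positivity), rpow_fifth_of_pow hg0]
  have hz : 0 ≤ b 0 ^ (1 / 5 : ℝ) := Real.rpow_nonneg ENNReal.toReal_nonneg _
  have h1 : k / (1 - θ ^ (1 / 5 : ℝ)) * b 0 ^ (1 / 5 : ℝ) ≤ t := by
    refine le_trans ?_ ht
    rw [mul_assoc]
    gcongr
  have ht0 : 0 ≤ t := (mul_nonneg hL.le hz).trans h1
  have h2 : b t ≤ 0 := (hanti _ _ (mul_nonneg hL.le hz) h1).trans h0.le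
  have h3 := (hE q₀ q h t ht0).1
  have h4 : gaugeQ (q t) ^ 5 ≤ 0 := by
    change _ ≤ b t at h3
    nlinarith
  exact gaugeQ_eq_zero.1
    (pow_eq_zero_iff (by norm_num) |>.1 (le_antisymm h4 (pow_nonneg (gaugeQ_nonneg _) _)))

theorem exists_gaugeQ_le {Ω : Set Plane} (hcomp : IsCompact Ω)
    (hzero : (0 : Plane) ∈ interior Ω) : ∃ C : ℝ, 0 < C ∧
      ∀ (q₀ : Phase) (q : ℝ → Phase), IsOptimal Ω q₀ q → ∀ t, 0 ≤ t →
        gaugeQ (q t) ≤ C * gaugeQ q₀ := by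
  obtain ⟨ε, c, C, hε, hc, hC, hE⟩ := exists_energy_bounds hcomp hzero
  refine ⟨(C / c) ^ (1 / 5 : ℝ), by positivity, fun q₀ q h t ht => ?_⟩
  have hq0 : q 0 = q₀ := h.1.choose_spec.init
  have hg0 : 0 ≤ gaugeQ q₀ := gaugeQ_nonneg _
  have hg : 0 ≤ gaugeQ (q t) := gaugeQ_nonneg _
  have h1 := (hE q₀ q h t ht).1
  have h2 := (hE q₀ q h 0 le_rfl).2.1
  have h3 := h.toReal_tailEnergy_anti hzero le_rfl ht
  rw [hq0] at h2
  have h4 : gaugeQ (q t) ^ 5 ≤ C / c * gaugeQ q₀ ^ 5 := by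
    rw [div_mul_eq_mul_div, le_div_iff₀ hc]
    linarith
  calc gaugeQ (q t) = (gaugeQ (q t) ^ 5) ^ (1 / 5 : ℝ) := (rpow_fifth_of_pow hg).symm
    _ ≤ (C / c * gaugeQ q₀ ^ 5) ^ (1 / 5 : ℝ) :=
      Real.rpow_le_rpow (by positivity) h4 (by norm_num)
    _ = _ := by rw [Real.mul_rpow (by positivity) (by positivity), rpow_fifth_of_pow hg0]

theorem IsOptimal.eq_zero_of_le {Ω : Set Plane} (hcomp : IsCompact Ω)
    (hzero : (0 : Plane) ∈ interior Ω) {q₀ : Phase} {q : ℝ → Phase} (h : IsOptimal Ω q₀ q)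
    {s t : ℝ} (hs : 0 ≤ s) (hqs : q s = 0) (hst : s ≤ t) : q t = 0 := by
  obtain ⟨C, hC, hE⟩ := exists_gaugeQ_le hcomp hzero
  have h1 := hE _ _ (h.shift hzero hs) (t - s) (sub_nonneg.2 hst)
  rw [hqs, gaugeQ_zero, mul_zero, sub_add_cancel] at h1
  exact gaugeQ_eq_zero.1 (le_antisymm h1 (gaugeQ_nonneg _))

/-- The first time at which a trajectory is at the origin. -/
noncomputable def hitTime (q : ℝ → Phase) : ℝ := sInf {t | 0 ≤ t ∧ q t = 0}

theorem hitTime_nonneg (q : ℝ → Phase) : 0 ≤ hitTime q := Real.sInf_nonneg fun _ ht => ht.1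

theorem hitTime_le {q : ℝ → Phase} {t : ℝ} (ht : 0 ≤ t) (hq : q t = 0) : hitTime q ≤ t :=
  csInf_le ⟨0, fun _ hs => hs.1⟩ ⟨ht, hq⟩

theorem IsOptimal.apply_hitTime {Ω : Set Plane} (hcomp : IsCompact Ω)
    (hzero : (0 : Plane) ∈ interior Ω) {q₀ : Phase} {q : ℝ → Phase} (h : IsOptimal Ω q₀ q) :
    q (hitTime q) = 0 := by
  obtain ⟨C, hC, hE⟩ := exists_extinction hcomp hzero
  have hne : {t | 0 ≤ t ∧ q t = 0}.Nonempty :=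
    ⟨C * gaugeQ q₀, mul_nonneg hC.le (gaugeQ_nonneg _), hE q₀ q h _ le_rfl⟩
  have hcl : IsClosed {t | 0 ≤ t ∧ q t = 0} :=
    h.1.continuousOn.preimage_isClosed_of_isClosed isClosed_Ici
      (isClosed_singleton (x := (0 : Phase)))
  exact (hcl.csInf_mem hne ⟨0, fun _ hs => hs.1⟩).2

/-- Integrating backwards from rest at time `t` gives `|y| ≤ Kt` and `|x₀| ≤ Kt²`; `K ≥ 1` absorbs
the square root. This is the lower bound for the hitting time. -/
theorem IsControlled.gaugeQ_le {Ω : Set Plane} {q₀ : Phase} {q : ℝ → Phase} {u : ℝ → Plane}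
    (h : IsControlled Ω q₀ q u) {K : ℝ} (hK1 : 1 ≤ K) (hK : ∀ v ∈ Ω, ‖v‖ ≤ K) {t : ℝ}
    (ht : 0 ≤ t) (hqt : q t = 0) : gaugeQ q₀ ≤ K * t := by
  have hy : ∀ s, 0 ≤ s → s ≤ t → ‖(q s).2‖ ≤ K * t := by
    intro s hs hst
    have h1 := h.deriv_y.norm_sub_le (h.norm_le hK) hs hst
    rw [hqt, Prod.snd_zero, zero_sub, norm_neg] at h1
    nlinarith
  have hx : ‖(q 0).1‖ ≤ K * t * |t - 0| := by
    have h1 := (h.deriv_x t ht).2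
    beta_reduce at h1
    rw [hqt, Prod.fst_zero] at h1
    rw [eq_neg_of_add_eq_zero_left h1.symm, norm_neg]
    refine intervalIntegral.norm_integral_le_of_norm_le_const fun s hs => ?_
    rw [uIoc_of_le ht] at hs
    exact hy s hs.1.le hs.2
  rw [sub_zero, abs_of_nonneg ht, h.init] at hx
  have hy0 := hy 0 le_rfl ht
  rw [h.init] at hy0
  refine max_le ?_ hy0
  rw [Real.sqrt_le_left (by positivity)]
  nlinarith [mul_nonneg (mul_nonneg (sub_nonneg.2 hK1) (by linarith : 0 ≤ K)) (mul_nonneg ht ht)]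

theorem IsOptimal.eq_zero_of_hitTime_le {Ω : Set Plane} (hcomp : IsCompact Ω)
    (hzero : (0 : Plane) ∈ interior Ω) {q₀ : Phase} {q : ℝ → Phase} (h : IsOptimal Ω q₀ q)
    {t : ℝ} (ht : hitTime q ≤ t) : q t = 0 :=
  h.eq_zero_of_le hcomp hzero (hitTime_nonneg q) (h.apply_hitTime hcomp hzero) ht

/-! ### First variation and the maximum principle -/

theorem IsControlled.tailEnergy_eq {Ω : Set Plane} {q₀ : Phase} {q : ℝ → Phase} {u : ℝ → Plane}
    (h : IsControlled Ω q₀ q u) {S : ℝ} (hS : 0 ≤ S) (hq : ∀ t, S ≤ t → q t = 0) :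
    tailEnergy q 0 = ENNReal.ofReal (∫ t in (0 : ℝ)..S, ‖(q t).1‖ ^ 2) := by
  rw [tailEnergy_eq_add h.deriv_x.continuousOn le_rfl hS, tailEnergy_eq_zero_of_forall hq, add_zero]

theorem intervalIntegrable_of_continuousOn_Ici {E : Type*} [NormedAddCommGroup E] {f : ℝ → E}
    (hf : ContinuousOn f (Ici 0)) {a b : ℝ} (ha : 0 ≤ a) (hb : 0 ≤ b) :
    IntervalIntegrable f volume a b :=
  (hf.mono fun _ ht => (le_min ha hb).trans ht.1).intervalIntegrable

/-- The first variation of the energy at an optimal trajectory is nonnegative. -/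
theorem IsOptimal.integral_inner_sub_nonneg {Ω : Set Plane} (hconv : Convex ℝ Ω) {q₀ : Phase}
    {q q' : ℝ → Phase} {u' : ℝ → Plane} (h : IsOptimal Ω q₀ q) (h' : IsControlled Ω q₀ q' u')
    {S : ℝ} (hS : 0 ≤ S) (hq : ∀ t, S ≤ t → q t = 0) (hq' : ∀ t, S ≤ t → q' t = 0) :
    0 ≤ ∫ t in (0 : ℝ)..S, inner ℝ ((q' t).1 - (q t).1) (q t).1 := by
  obtain ⟨⟨u, hu⟩, hmin⟩ := isOptimal_iff.1 h
  have cx := hu.deriv_x.continuousOn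
  have cx' := h'.deriv_x.continuousOn
  set A := ∫ t in (0 : ℝ)..S, (inner ℝ ((q' t).1 - (q t).1) (q t).1 : ℝ) with hA
  set D := ∫ t in (0 : ℝ)..S, ‖(q' t).1 - (q t).1‖ ^ 2 with hD
  have iA : IntervalIntegrable (fun t => (inner ℝ ((q' t).1 - (q t).1) (q t).1 : ℝ)) volume 0 S :=
    intervalIntegrable_of_continuousOn_Ici ((cx'.sub cx).inner cx) le_rfl hS
  have iD : IntervalIntegrable (fun t => ‖(q' t).1 - (q t).1‖ ^ 2) volume 0 S :=
    intervalIntegrable_of_continuousOn_Ici ((cx'.sub cx).norm.pow 2) le_rfl hS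
  have iq : IntervalIntegrable (fun t => ‖(q t).1‖ ^ 2) volume 0 S :=
    intervalIntegrable_of_continuousOn_Ici (cx.norm.pow 2) le_rfl hS
  -- Moving a fraction `l` towards `q'` changes the energy by `2lA + l²D`; this is divided by `l`
  -- before `l → 0`.
  have key : ∀ l : ℝ, 0 < l → l ≤ 1 → 0 ≤ 2 * A + l * D := by
    intro l hl hl1
    have hc := hu.combo hconv h' (a := 1 - l) (b := l) (by linarith) hl.le (by ring)
    rw [← add_smul, sub_add_cancel, one_smul] at hc
    have h1 := hmin _ ⟨_, hc⟩
    rw [hu.tailEnergy_eq hS hq, hc.tailEnergy_eq hS (fun t ht => by simp [hq t ht, hq' t ht]),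
      ENNReal.ofReal_le_ofReal_iff (intervalIntegral.integral_nonneg hS fun t _ => by positivity)]
      at h1
    have e : ∫ t in (0 : ℝ)..S, ‖((1 - l) • q t + l • q' t).1‖ ^ 2 =
        (∫ t in (0 : ℝ)..S, ‖(q t).1‖ ^ 2) + 2 * l * A + l ^ 2 * D := by
      rw [hA, hD, ← intervalIntegral.integral_const_mul, ← intervalIntegral.integral_const_mul,
        ← intervalIntegral.integral_add iq (iA.const_mul _),
        ← intervalIntegral.integral_add (iq.add (iA.const_mul _)) (iD.const_mul _)]
      refine intervalIntegral.integral_congr fun t _ => ?_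
      have e1 : ((1 - l) • q t + l • q' t).1 = (q t).1 + l • ((q' t).1 - (q t).1) := by
        rw [Prod.fst_add, Prod.smul_fst, Prod.smul_fst]
        module
      beta_reduce
      rw [e1, norm_add_sq_real, real_inner_smul_right, norm_smul, mul_pow, Real.norm_eq_abs, sq_abs,
        real_inner_comm]
      ring
    rw [e] at h1
    have h2 : 0 ≤ l * (2 * A + l * D) := by linarith
    exact nonneg_of_mul_nonneg_right h2 hl
  have hlim : Tendsto (fun l : ℝ => 2 * A + l * D) (𝓝[>] 0) (𝓝 (2 * A + 0 * D)) := by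
    refine Tendsto.mono_left ?_ nhdsWithin_le_nhds
    exact Continuous.tendsto (by fun_prop) 0
  have h0 : 0 ≤ 2 * A + 0 * D := by
    refine ge_of_tendsto hlim ?_
    filter_upwards [Ioo_mem_nhdsGT (show (0 : ℝ) < 1 by norm_num)] with l hl
    exact key l hl.1 hl.2.le
  linarith

theorem SolvesDeriv.primitive {g : ℝ → Plane} (hg : ContinuousOn g (Ici 0)) {a : ℝ} (ha : 0 ≤ a) :
    SolvesDeriv (fun t => ∫ s in a..t, g s) g := by
  intro t ht
  have i := fun {b c : ℝ} (hb : 0 ≤ b) (hc : 0 ≤ c) =>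
    intervalIntegrable_of_continuousOn_Ici hg hb hc
  exact ⟨i le_rfl ht,
    (intervalIntegral.integral_add_adjacent_intervals (i ha le_rfl) (i le_rfl ht)).symm⟩

/-- The solution of the adjoint equations along `q` that vanishes at the hitting time of the
origin. -/
noncomputable def adjointOf (q : ℝ → Phase) (t : ℝ) : Phase :=
  (∫ s in hitTime q..t, (q s).1, ∫ s in hitTime q..t, -∫ r in hitTime q..s, (q r).1)

theorem adjointOf_fst {q : ℝ → Phase} (hq : ContinuousOn q (Ici 0)) :
    SolvesDeriv (fun t => (adjointOf q t).1) (fun t => (q t).1) :=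
  SolvesDeriv.primitive (continuous_fst.comp_continuousOn hq) (hitTime_nonneg q)

theorem adjointOf_snd {q : ℝ → Phase} (hq : ContinuousOn q (Ici 0)) :
    SolvesDeriv (fun t => (adjointOf q t).2) (fun t => -(adjointOf q t).1) :=
  SolvesDeriv.primitive (adjointOf_fst hq).continuousOn.neg (hitTime_nonneg q)

theorem IsOptimal.adjointOf_eq_zero {Ω : Set Plane} (hcomp : IsCompact Ω)
    (hzero : (0 : Plane) ∈ interior Ω) {q₀ : Phase} {q : ℝ → Phase} (h : IsOptimal Ω q₀ q)
    {t : ℝ} (ht : hitTime q ≤ t) : adjointOf q t = 0 := by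
  have h1 : ∀ s, hitTime q ≤ s → ∫ r in hitTime q..s, (q r).1 = 0 := by
    intro s hs
    rw [intervalIntegral.integral_congr (g := fun _ => 0), intervalIntegral.integral_zero]
    intro r hr
    rw [uIcc_of_le hs] at hr
    simp [h.eq_zero_of_hitTime_le hcomp hzero hr.1]
  refine Prod.ext (h1 t ht) ?_
  change ∫ s in hitTime q..t, -∫ r in hitTime q..s, (q r).1 = 0
  rw [intervalIntegral.integral_congr (g := fun _ => 0), intervalIntegral.integral_zero]
  intro r hr
  rw [uIcc_of_le ht] at hr
  simp [h1 r hr.1]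

theorem exists_isControlled {Ω : Set Plane} (q₀ : Phase) {u : ℝ → Plane}
    (hint : ∀ t, 0 ≤ t → IntervalIntegrable u volume 0 t)
    (hu : ∀ᵐ t ∂(volume.restrict (Ici (0 : ℝ))), u t ∈ Ω) : ∃ q, IsControlled Ω q₀ q u := by
  set y : ℝ → Plane := fun t => q₀.2 + ∫ s in (0 : ℝ)..t, u s with hy
  have dy : SolvesDeriv y u := fun t ht => ⟨hint t ht, by simp [hy]⟩
  refine ⟨fun t => (q₀.1 + ∫ s in (0 : ℝ)..t, y s, y t), ⟨?_, ?_, dy, hu⟩⟩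
  · simp [hy]
  · exact fun t ht =>
      ⟨intervalIntegrable_of_continuousOn_Ici dy.continuousOn le_rfl ht, by simp⟩

/-- The integrated maximum principle. -/
theorem IsOptimal.integral_adjointOf_le {Ω : Set Plane} (hconv : Convex ℝ Ω) (hcomp : IsCompact Ω)
    (hzero : (0 : Plane) ∈ interior Ω) {q₀ : Phase} {q q' : ℝ → Phase} {u u' : ℝ → Plane}
    (h : IsOptimal Ω q₀ q) (hu : IsControlled Ω q₀ q u) (hu' : IsControlled Ω q₀ q' u') {S : ℝ}
    (hS : hitTime q ≤ S) :
    ∫ t in (0 : ℝ)..S, inner ℝ (adjointOf q t).2 (u' t - u t) ≤ 0 := by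
  have hS0 : 0 ≤ S := (hitTime_nonneg q).trans hS
  obtain ⟨M, C, hM, -, hsteer⟩ := exists_steering hzero
  -- The competitor need not end at the origin, so it is steered there after time `S`. The adjoint
  -- vanishes after `S`, and the added control contributes nothing.
  obtain ⟨r, v, hr, hr0, -⟩ := hsteer (q' S)
  have hc := hu'.concat hS0 hr
  set w : ℝ → Phase := fun t => if t ≤ S then q' t else r (t - S) with hw
  set uw : ℝ → Plane := fun t => if t ≤ S then u' t else v (t - S) with huw
  set S' := S + M * gaugeQ (q' S) with hS'
  have hM0 : 0 ≤ M * gaugeQ (q' S) := mul_nonneg hM.le (gaugeQ_nonneg _)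
  have hSS' : S ≤ S' := by linarith
  have hS'0 : 0 ≤ S' := hS0.trans hSS'
  have hw0 : ∀ t, S' ≤ t → w t = 0 := by
    intro t ht
    rcases (hSS'.trans ht).eq_or_lt with rfl | hlt
    · have h1 : M * gaugeQ (q' S) = 0 := by linarith
      have h2 := hr0 0 h1.le
      rw [hr.init] at h2
      simpa [hw] using h2
    · simp only [hw, not_le.2 hlt, if_false]
      exact hr0 _ (by linarith)
  have h1 := h.integral_inner_sub_nonneg hconv hc hS'0
    (fun t ht => h.eq_zero_of_hitTime_le hcomp hzero (hS.trans (hSS'.trans ht))) hw0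
  have hqc := hu.continuousOn
  have dy := hc.deriv_y.sub hu.deriv_y
  have h2 := integral_pairing (adjointOf_fst hqc) (adjointOf_snd hqc)
    (hc.deriv_x.sub hu.deriv_x) dy hS'0
  rw [h.adjointOf_eq_zero hcomp hzero (hS.trans hSS'), hc.init, hu.init] at h2
  simp only [Prod.fst_zero, Prod.snd_zero, inner_zero_left, sub_self, inner_zero_right, add_zero]
    at h2
  have h3 : ∫ t in (0 : ℝ)..S', inner ℝ (adjointOf q t).2 (uw t - u t) =
      ∫ t in (0 : ℝ)..S, inner ℝ (adjointOf q t).2 (u' t - u t) := by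
    have hint := fun {a b : ℝ} (ha : 0 ≤ a) (hb : 0 ≤ b) =>
      dy.intervalIntegrable_inner_right (adjointOf_snd hqc).continuousOn ha hb
    rw [← intervalIntegral.integral_add_adjacent_intervals (hint le_rfl hS0) (hint hS0 hS'0)]
    have h4 : ∫ t in S..S', inner ℝ (adjointOf q t).2 (uw t - u t) = (0 : ℝ) := by
      rw [intervalIntegral.integral_congr (g := fun _ => 0), intervalIntegral.integral_zero]
      intro t ht
      rw [uIcc_of_le hSS'] at ht
      simp [h.adjointOf_eq_zero hcomp hzero (hS.trans ht.1)]
    rw [h4, add_zero]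
    refine intervalIntegral.integral_congr fun t ht => ?_
    rw [uIcc_of_le hS0] at ht
    simp [huw, ht.2]
  rw [h3] at h2
  linarith

/-- A needle variation: the control is replaced by the constant `v` on `(a, b]` only. -/
theorem IsOptimal.integral_adjointOf_const_le {Ω : Set Plane} (hconv : Convex ℝ Ω)
    (hcomp : IsCompact Ω) (hzero : (0 : Plane) ∈ interior Ω) {q₀ : Phase} {q : ℝ → Phase}
    {u : ℝ → Plane} (h : IsOptimal Ω q₀ q) (hu : IsControlled Ω q₀ q u) {v : Plane} (hv : v ∈ Ω)
    {a b : ℝ} (ha : 0 ≤ a) (hab : a ≤ b) :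
    ∫ t in a..b, inner ℝ (adjointOf q t).2 (v - u t) ≤ 0 := by
  classical
  set w : ℝ → Plane := (Ioc a b).piecewise (fun _ => v) u with hw
  have hwint : ∀ t, 0 ≤ t → IntervalIntegrable w volume 0 t := by
    intro t ht
    have h1 := (hu.deriv_y t ht).1
    rw [intervalIntegrable_iff] at h1 ⊢
    have h2 : IntegrableOn (fun _ => v) (uIoc 0 t) volume :=
      intervalIntegrable_iff.1 intervalIntegrable_const
    exact Integrable.piecewise measurableSet_Ioc (Integrable.integrableOn h2)
      (Integrable.integrableOn h1)
  have hwmem : ∀ᵐ t ∂(volume.restrict (Ici (0 : ℝ))), w t ∈ Ω := by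
    filter_upwards [hu.mem] with t ht
    by_cases hta : t ∈ Ioc a b
    · simpa [hw, hta] using hv
    · simpa only [hw, piecewise_eq_of_notMem _ _ _ hta] using ht
  obtain ⟨q', hq'⟩ := exists_isControlled q₀ hwint hwmem
  set S := max b (hitTime q) with hS
  have hS0 : 0 ≤ S := (hitTime_nonneg q).trans (le_max_right _ _)
  have h1 := h.integral_adjointOf_le hconv hcomp hzero hu hq' (le_max_right b (hitTime q))
  have h2 : (fun t => (inner ℝ (adjointOf q t).2 (w t - u t) : ℝ)) =
      (Ioc a b).indicator fun t => inner ℝ (adjointOf q t).2 (v - u t) := by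
    ext t
    by_cases hta : t ∈ Ioc a b
    · simp [hw, hta]
    · rw [hw, piecewise_eq_of_notMem _ _ _ hta, indicator_of_notMem hta, sub_self, inner_zero_right]
  rw [h2, intervalIntegral.integral_of_le hS0, setIntegral_indicator measurableSet_Ioc,
    inter_eq_self_of_subset_right (Ioc_subset_Ioc ha (le_max_left _ _)),
    ← intervalIntegral.integral_of_le hab] at h1
  exact h1

/-- The primitive is antitone, and `f` is its derivative almost everywhere. -/
theorem ae_nonpos_of_forall_integral_nonpos {f : ℝ → ℝ}
    (hf : ∀ t, 0 ≤ t → IntervalIntegrable f volume 0 t)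
    (h : ∀ a b, 0 ≤ a → a ≤ b → ∫ t in a..b, f t ≤ 0) :
    ∀ᵐ t ∂(volume.restrict (Ici (0 : ℝ))), f t ≤ 0 := by
  rw [ae_restrict_iff' measurableSet_Ici]
  have h1 : ∀ᵐ t, ∀ n : ℕ, t ∈ uIcc (0 : ℝ) n → ∀ c ∈ uIcc (0 : ℝ) n,
      HasDerivAt (fun x => ∫ s in c..x, f s) (f t) t :=
    ae_all_iff.2 fun n => (hf n (Nat.cast_nonneg n)).ae_hasDerivAt_integral
  filter_upwards [h1, Measure.ae_ne volume (0 : ℝ)] with t ht ht0 h0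
  obtain ⟨n, hn⟩ := exists_nat_gt t
  have hn0 : (0 : ℝ) ≤ n := Nat.cast_nonneg n
  have h2 := ht n (by rw [uIcc_of_le hn0]; exact ⟨h0, hn.le⟩) 0 left_mem_uIcc
  have hanti : AntitoneOn (fun x => ∫ s in (0 : ℝ)..x, f s) (Ici 0) := by
    intro a ha b hb hab
    have := h a b ha hab
    beta_reduce
    rw [← intervalIntegral.integral_add_adjacent_intervals (hf a ha)
      ((hf a ha).symm.trans (hf b hb))]
    linarith
  have h3 : derivWithin (fun x => ∫ s in (0 : ℝ)..x, f s) (Ici 0) t ≤ 0 := hanti.derivWithin_nonpos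
  rwa [h2.hasDerivWithinAt.derivWithin (uniqueDiffOn_Ici 0 t h0)] at h3

/-- The Pontryagin maximum principle. -/
theorem IsOptimal.isAdjoint_adjointOf {Ω : Set Plane} (hconv : Convex ℝ Ω) (hcomp : IsCompact Ω)
    (hzero : (0 : Plane) ∈ interior Ω) {q₀ : Phase} {q : ℝ → Phase} (h : IsOptimal Ω q₀ q) :
    IsAdjoint Ω q₀ q (adjointOf q) := by
  obtain ⟨u, hu⟩ := h.1
  have hqc := hu.continuousOn
  refine ⟨adjointOf_fst hqc, adjointOf_snd hqc, u, hu, ?_⟩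
  -- The exceptional null set depends on `v`, so the inequality is obtained on a countable dense
  -- subset and extended by continuity.
  obtain ⟨D, hD, hDc, hDd⟩ :=
    (TopologicalSpace.IsSeparable.of_separableSpace Ω).exists_countable_dense_subset
  have h1 : ∀ v ∈ D, ∀ᵐ t ∂(volume.restrict (Ici (0 : ℝ))),
      (inner ℝ (adjointOf q t).2 (v - u t) : ℝ) ≤ 0 := by
    intro v hv
    refine ae_nonpos_of_forall_integral_nonpos (fun t ht => ?_) fun a b ha hab =>
      h.integral_adjointOf_const_le hconv hcomp hzero hu (hD hv) ha hab
    have hv' : SolvesDeriv (fun t => t • v) fun _ => v :=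
      SolvesDeriv.of_hasDerivAt (fun t => by simpa using (hasDerivAt_id' t).smul_const v)
        continuous_const
    exact (hv'.sub hu.deriv_y).intervalIntegrable_inner_right (adjointOf_snd hqc).continuousOn
      le_rfl ht
  filter_upwards [(ae_ball_iff hDc).2 h1] with t ht v hv
  have hcl : IsClosed
      {v : Plane | (inner ℝ (adjointOf q t).2 v : ℝ) ≤ inner ℝ (adjointOf q t).2 (u t)} :=
    isClosed_le (by fun_prop) continuous_const
  refine closure_minimal (fun v hv => ?_) hcl (hDd hv)
  have := ht v hv
  rw [inner_sub_right] at this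
  simpa using this

/-! ### Extinction and uniqueness of adjoint functions -/

theorem mul_norm_le_inner_of_isMaxOn {Ω : Set Plane} {r : ℝ} (hr : 0 < r)
    (hball : ∀ v : Plane, ‖v‖ ≤ r → v ∈ Ω) {ψ u : Plane}
    (h : IsMaxOn (fun v => (inner ℝ ψ v : ℝ)) Ω u) : r * ‖ψ‖ ≤ inner ℝ ψ u := by
  by_cases hψ : ψ = 0
  · simp [hψ]
  have hn : 0 < ‖ψ‖ := norm_pos_iff.2 hψ
  have h1 : (inner ℝ ψ ((r / ‖ψ‖) • ψ) : ℝ) ≤ inner ℝ ψ u := by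
    refine h (hball _ ?_)
    rw [norm_smul, Real.norm_of_nonneg (by positivity), div_mul_cancel₀ _ hn.ne']
  rw [real_inner_smul_right, real_inner_self_eq_norm_sq] at h1
  calc r * ‖ψ‖ = r / ‖ψ‖ * ‖ψ‖ ^ 2 := by field_simp
    _ ≤ _ := h1

/-- Adjoint functions of optimal trajectories vanish once the trajectory is at the origin. -/
theorem IsAdjoint.eq_zero {Ω : Set Plane} (hzero : (0 : Plane) ∈ interior Ω) {q₀ : Phase}
    {q p : ℝ → Phase} (hp : IsAdjoint Ω q₀ q p) {T : ℝ} (hT : 0 ≤ T) (hq : ∀ t, T ≤ t → q t = 0)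
    {t : ℝ} (ht : T ≤ t) : p t = 0 := by
  obtain ⟨hφ, hψ, u, hu, hmax⟩ := hp
  obtain ⟨r, hr, hball⟩ := exists_closedBall_subset hzero
  have hus := hu.shift hT
  -- Along `q = 0` the pairing identity reads `∫⟨ψ, u⟩ = 0`, whereas the integrand is at least
  -- `r|ψ|`.
  have hψ0 : ∀ s, T ≤ s → (p s).2 = 0 := by
    intro s hs
    by_contra hne
    have hS : 0 < s - T + 1 := by linarith
    have h1 := integral_pairing (hφ.shift hT) (hψ.shift hT) hus.deriv_x hus.deriv_y hS.le
    have h0 : ∀ t, 0 ≤ t → q (t + T) = 0 := fun t ht => hq _ (by linarith)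
    rw [h0 _ hS.le, h0 0 le_rfl, intervalIntegral.integral_congr (g := fun _ => 0) (fun t ht => by
      rw [uIcc_of_le hS.le] at ht
      simp [h0 t ht.1])] at h1
    simp only [intervalIntegral.integral_zero, Prod.fst_zero, Prod.snd_zero, inner_zero_right,
      add_zero, zero_add, sub_self] at h1
    have hc : ContinuousOn (fun t => r * ‖(p (t + T)).2‖) (Ici 0) :=
      ((hψ.shift hT).continuousOn.norm.const_mul r)
    have h2 : 0 < ∫ t in (0 : ℝ)..(s - T + 1), r * ‖(p (t + T)).2‖ := by
      refine intervalIntegral.integral_pos hS (hc.mono fun t ht => ht.1)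
        (fun t _ => by positivity) ⟨s - T, ⟨by linarith, by linarith⟩, ?_⟩
      rw [sub_add_cancel]
      exact mul_pos hr (norm_pos_iff.2 hne)
    have h3 : ∫ t in (0 : ℝ)..(s - T + 1), r * ‖(p (t + T)).2‖ ≤
        ∫ t in (0 : ℝ)..(s - T + 1), inner ℝ (p (t + T)).2 (u (t + T)) := by
      refine intervalIntegral.integral_mono_ae_restrict hS.le
        (intervalIntegrable_of_continuousOn_Ici hc le_rfl hS.le)
        (hus.deriv_y.intervalIntegrable_inner_right (hψ.shift hT).continuousOn le_rfl hS.le) ?_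
      rw [ae_restrict_iff' measurableSet_Ici] at hmax
      refine (ae_restrict_iff' measurableSet_Icc).2 ?_
      filter_upwards [(measurePreserving_add_right volume T).quasiMeasurePreserving.ae hmax]
        with t ht h't
      exact mul_norm_le_inner_of_isMaxOn hr hball (ht (add_nonneg h't.1 hT))
    linarith
  refine Prod.ext ?_ (hψ0 t ht)
  -- Since `x = 0`, `φ` is constant; `ψ̇ = -φ` with `ψ = 0` then forces `φ = 0`.
  have hconst : ∀ s, t ≤ s → (p s).1 = (p t).1 := by
    intro s hs
    have h1 := hφ.sub_eq (hT.trans ht) (hT.trans (ht.trans hs))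
    rw [intervalIntegral.integral_congr (g := fun _ => 0) (fun r hr => by
      rw [uIcc_of_le hs] at hr
      simp [hq r (ht.trans hr.1)]), intervalIntegral.integral_zero] at h1
    exact sub_eq_zero.1 h1
  have h1 := hψ.sub_eq (hT.trans ht) (show 0 ≤ t + 1 by linarith)
  rw [hψ0 t ht, hψ0 (t + 1) (by linarith), intervalIntegral.integral_congr
    (g := fun _ => -(p t).1) (fun r hr => by
      rw [uIcc_of_le (by linarith)] at hr
      simp [hconst r hr.1])] at h1
  simpa using h1.symm

/-- Both functions solve the same linear equations backwards from zero data at `T`. -/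
theorem IsAdjoint.eqOn {Ω : Set Plane} (hzero : (0 : Plane) ∈ interior Ω) {q₀ : Phase}
    {q p p' : ℝ → Phase} (hp : IsAdjoint Ω q₀ q p) (hp' : IsAdjoint Ω q₀ q p') {T : ℝ}
    (hT : 0 ≤ T) (hq : ∀ t, T ≤ t → q t = 0) : EqOn p p' (Ici 0) := by
  have h1 := hp.eq_zero hzero hT hq le_rfl
  have h2 := hp'.eq_zero hzero hT hq le_rfl
  have hφ : ∀ t, 0 ≤ t → (p t).1 = (p' t).1 := by
    intro t ht
    have h3 := hp.1.sub_eq hT ht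
    have h4 := hp'.1.sub_eq hT ht
    simp only [h1, h2, Prod.fst_zero, sub_zero] at h3 h4
    rw [h3, h4]
  intro t ht
  refine Prod.ext (hφ t ht) ?_
  have h3 := hp.2.1.sub_eq hT ht
  have h4 := hp'.2.1.sub_eq hT ht
  simp only [h1, h2, Prod.snd_zero, sub_zero] at h3 h4
  rw [h3, h4]
  refine intervalIntegral.integral_congr fun s hs => ?_
  simp [hφ s ((le_min hT ht).trans hs.1)]

/-! ### Monotonicity of the extremal flow -/

theorem covector_apply (p q : Phase) : covector p q = inner ℝ p.1 q.1 + inner ℝ p.2 q.2 := by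
  simp [covector]

theorem covector_sub (p p' : Phase) : covector (p - p') = covector p - covector p' := by
  ext q <;> simp [covector_apply, inner_sub_left]

theorem covector_injective : Function.Injective covector := by
  intro p p' h
  have h1 : covector (p - p') (p - p') = 0 := by rw [covector_sub, h, sub_self]; rfl
  rw [covector_apply, real_inner_self_eq_norm_sq, real_inner_self_eq_norm_sq] at h1
  have h2 : ‖(p - p').1‖ = 0 := by nlinarith [sq_nonneg ‖(p - p').1‖, sq_nonneg ‖(p - p').2‖]
  have h3 : ‖(p - p').2‖ = 0 := by nlinarith [sq_nonneg ‖(p - p').1‖, sq_nonneg ‖(p - p').2‖]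
  exact sub_eq_zero.1 (Prod.ext (norm_eq_zero.1 h2) (norm_eq_zero.1 h3))

theorem abs_covector_le_add (p q : Phase) :
    |covector p q| ≤ ‖p.1‖ * ‖q.1‖ + ‖p.2‖ * ‖q.2‖ := by
  rw [covector_apply]
  exact (abs_add_le _ _).trans
    (add_le_add (abs_real_inner_le_norm _ _) (abs_real_inner_le_norm _ _))

theorem abs_covector_le (p q : Phase) : |covector p q| ≤ 2 * ‖p‖ * ‖q‖ := by
  have h1 := norm_fst_le p
  have h2 := norm_snd_le p
  have h3 := norm_fst_le q
  have h4 := norm_snd_le q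
  calc _ ≤ ‖p.1‖ * ‖q.1‖ + ‖p.2‖ * ‖q.2‖ := abs_covector_le_add p q
    _ ≤ ‖p‖ * ‖q‖ + ‖p‖ * ‖q‖ := by gcongr
    _ = _ := by ring

theorem IsAdjoint.shift {Ω : Set Plane} {q₀ : Phase} {q p : ℝ → Phase} (h : IsAdjoint Ω q₀ q p)
    {s : ℝ} (hs : 0 ≤ s) : IsAdjoint Ω (q s) (fun t => q (t + s)) (fun t => p (t + s)) := by
  obtain ⟨hφ, hψ, u, hu, hmax⟩ := h
  refine ⟨hφ.shift hs, hψ.shift hs, _, hu.shift hs, ?_⟩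
  rw [ae_restrict_iff' measurableSet_Ici] at hmax ⊢
  filter_upwards [(measurePreserving_add_right volume s).quasiMeasurePreserving.ae hmax]
    with t ht h't
  exact ht (add_nonneg h't hs)

theorem IsAdjoint.init {Ω : Set Plane} {q₀ : Phase} {q p : ℝ → Phase} (h : IsAdjoint Ω q₀ q p) :
    q 0 = q₀ := h.2.2.choose_spec.1.init

theorem isAdjoint_zero {Ω : Set Plane} (hzero : (0 : Plane) ∈ Ω) :
    IsAdjoint Ω 0 (fun _ => 0) (fun _ => 0) := by
  have h := IsControlled.zero hzero
  refine ⟨h.deriv_x, fun t _ => by simp, _, h, ?_⟩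
  refine Eventually.of_forall fun t v _ => ?_
  simp

/-- Monotonicity of the extremal flow. -/
theorem IsAdjoint.integral_norm_sub_sq_le {Ω : Set Plane} {q₀ q₀' : Phase}
    {q p q' p' : ℝ → Phase} (h : IsAdjoint Ω q₀ q p) (h' : IsAdjoint Ω q₀' q' p') {S : ℝ}
    (hS : 0 ≤ S) (hp : p S = 0) (hp' : p' S = 0) :
    ∫ t in (0 : ℝ)..S, ‖(q t - q' t).1‖ ^ 2 ≤ -covector (p 0 - p' 0) (q₀ - q₀') := by
  obtain ⟨hφ, hψ, u, hu, hmax⟩ := h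
  obtain ⟨hφ', hψ', u', hu', hmax'⟩ := h'
  have dψ : SolvesDeriv (fun t => (p t).2 - (p' t).2) (fun t => -((p t).1 - (p' t).1)) := by
    refine (hψ.sub hψ').congr (fun _ _ => rfl) fun t _ => ?_
    simp only
    abel
  have dy := hu.deriv_y.sub hu'.deriv_y
  have h1 := integral_pairing (hφ.sub hφ') dψ (hu.deriv_x.sub hu'.deriv_x) dy hS
  -- Each control is tested as a competitor in the maximum condition of the other; adding the two
  -- inequalities gives `⟨δψ, δu⟩ ≥ 0`.
  have h2 : 0 ≤ ∫ t in (0 : ℝ)..S, inner ℝ ((p t).2 - (p' t).2) (u t - u' t) := by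
    refine intervalIntegral.integral_nonneg_of_ae_restrict hS ?_
    have hsub : Icc 0 S ⊆ Ici (0 : ℝ) := fun t ht => ht.1
    filter_upwards [ae_restrict_of_ae_restrict_of_subset hsub hmax,
      ae_restrict_of_ae_restrict_of_subset hsub hmax',
      ae_restrict_of_ae_restrict_of_subset hsub hu.mem,
      ae_restrict_of_ae_restrict_of_subset hsub hu'.mem] with t m1 m2 m3 m4
    have e1 : (inner ℝ (p t).2 (u' t) : ℝ) ≤ inner ℝ (p t).2 (u t) := m1 m4
    have e2 : (inner ℝ (p' t).2 (u t) : ℝ) ≤ inner ℝ (p' t).2 (u' t) := m2 m3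
    rw [inner_sub_left, inner_sub_right, inner_sub_right]
    change (0 : ℝ) ≤ _
    linarith
  have h3 : ∫ t in (0 : ℝ)..S, inner ℝ ((q t).1 - (q' t).1) ((q t).1 - (q' t).1) =
      ∫ t in (0 : ℝ)..S, ‖(q t - q' t).1‖ ^ 2 :=
    intervalIntegral.integral_congr fun t _ => real_inner_self_eq_norm_sq _
  rw [h3] at h1
  simp only [hp, hp', sub_self, Prod.fst_zero, Prod.snd_zero, inner_zero_left, add_zero, zero_sub,
    hu.init, hu'.init] at h1
  rw [covector_apply]
  simp only [Prod.fst_sub, Prod.snd_sub] at h1 ⊢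
  linarith

theorem IsOptimal.exists_forall_eq_zero {Ω : Set Plane} (hcomp : IsCompact Ω)
    (hzero : (0 : Plane) ∈ interior Ω) {q₀ q₀' : Phase} {q q' : ℝ → Phase}
    (h : IsOptimal Ω q₀ q) (h' : IsOptimal Ω q₀' q') :
    ∃ S, 0 ≤ S ∧ (∀ t, S ≤ t → q t = 0) ∧ ∀ t, S ≤ t → q' t = 0 :=
  ⟨max (hitTime q) (hitTime q'), (hitTime_nonneg q).trans (le_max_left _ _),
    fun _ ht => h.eq_zero_of_hitTime_le hcomp hzero ((le_max_left _ _).trans ht),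
    fun _ ht => h'.eq_zero_of_hitTime_le hcomp hzero ((le_max_right _ _).trans ht)⟩

/-- Quantitative strict monotonicity of `-E`. -/
theorem exists_gaugeQ_sub_pow_le {Ω : Set Plane} (hcomp : IsCompact Ω)
    (hzero : (0 : Plane) ∈ interior Ω) : ∃ c : ℝ, 0 < c ∧
      ∀ (q₀ q₀' : Phase) (q p q' p' : ℝ → Phase), IsOptimal Ω q₀ q → IsOptimal Ω q₀' q' →
        IsAdjoint Ω q₀ q p → IsAdjoint Ω q₀' q' p' → ∀ t, 0 ≤ t →
          c * gaugeQ (q t - q' t) ^ 5 ≤ -covector (p 0 - p' 0) (q₀ - q₀') := by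
  obtain ⟨K, hK1, hK⟩ := exists_forall_norm_le hcomp
  refine ⟨(1 / (4 * (2 * K))) ^ 3 / 48, by positivity, ?_⟩
  intro q₀ q₀' q p q' p' h h' hp hp' t ht
  obtain ⟨S, hS, hq0, hq0'⟩ := h.exists_forall_eq_zero hcomp hzero h'
  obtain ⟨u, hu⟩ := h.1
  obtain ⟨u', hu'⟩ := h'.1
  have h1 := hu.ofReal_gaugeQ_sub_pow_le hu' hK1 hK ht
  have h2 := h1.trans (tailEnergy_anti _ ht)
  rw [tailEnergy_eq_add (hu.deriv_x.sub hu'.deriv_x).continuousOn le_rfl hS,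
    tailEnergy_eq_zero_of_forall (fun s hs => by simp [hq0 s hs, hq0' s hs]), add_zero,
    ENNReal.ofReal_le_ofReal_iff (intervalIntegral.integral_nonneg hS fun s _ => by positivity)]
    at h2
  exact h2.trans (hp.integral_norm_sub_sq_le hp' hS (hp.eq_zero hzero hS hq0 le_rfl)
    (hp'.eq_zero hzero hS hq0' le_rfl))

theorem IsOptimal.zero {Ω : Set Plane} (hzero : (0 : Plane) ∈ Ω) :
    IsOptimal Ω 0 (fun _ => 0) := by
  refine isOptimal_iff.2 ⟨⟨_, IsControlled.zero hzero⟩, fun q' _ => ?_⟩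
  rw [tailEnergy_eq_zero_of_forall fun _ _ => rfl]
  exact zero_le

/-- Monotonicity against the extremal resting at the origin. -/
theorem exists_gaugeQ_pow_le {Ω : Set Plane} (hcomp : IsCompact Ω)
    (hzero : (0 : Plane) ∈ interior Ω) : ∃ c : ℝ, 0 < c ∧
      ∀ (q₀ : Phase) (q p : ℝ → Phase), IsOptimal Ω q₀ q → IsAdjoint Ω q₀ q p →
        c * gaugeQ q₀ ^ 5 ≤ -covector (p 0) q₀ := by
  obtain ⟨c, hc, hE⟩ := exists_gaugeQ_sub_pow_le hcomp hzero
  refine ⟨c, hc, fun q₀ q p h hp => ?_⟩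
  have := hE q₀ 0 q p _ _ h (IsOptimal.zero (interior_subset hzero)) hp
    (isAdjoint_zero (interior_subset hzero)) 0 le_rfl
  simpa [hp.init] using this

/-! ### Subgradients of the Bellman function -/

theorem IsOptimal.bellman_eq {Ω : Set Plane} {q₀ : Phase} {q : ℝ → Phase}
    (h : IsOptimal Ω q₀ q) : bellman Ω q₀ = 2⁻¹ * tailEnergy q 0 := by
  rw [← cost_eq]
  exact le_antisymm (iInf₂_le q h.1) (le_iInf₂ h.2)

theorem IsOptimal.toReal_bellman {Ω : Set Plane} {q₀ : Phase} {q : ℝ → Phase}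
    (h : IsOptimal Ω q₀ q) : (bellman Ω q₀).toReal = (tailEnergy q 0).toReal / 2 := by
  rw [h.bellman_eq, ENNReal.toReal_mul]
  simp
  ring

/-- `-p(0)` is a subgradient of the Bellman function. -/
theorem IsOptimal.toReal_bellman_sub_le {Ω : Set Plane} (hcomp : IsCompact Ω)
    (hzero : (0 : Plane) ∈ interior Ω) {q₀ q₀' : Phase} {q q' p : ℝ → Phase}
    (h : IsOptimal Ω q₀ q) (h' : IsOptimal Ω q₀' q') (hp : IsAdjoint Ω q₀ q p) :
    (bellman Ω q₀).toReal - covector (p 0) (q₀' - q₀) ≤ (bellman Ω q₀').toReal := by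
  obtain ⟨S, hS, hq0, hq0'⟩ := h.exists_forall_eq_zero hcomp hzero h'
  obtain ⟨u', hu'⟩ := h'.1
  have hpS := hp.eq_zero hzero hS hq0 le_rfl
  obtain ⟨hφ, hψ, u, hu, hmax⟩ := hp
  rw [h.toReal_bellman, h'.toReal_bellman, hu.tailEnergy_eq hS hq0, hu'.tailEnergy_eq hS hq0',
    ENNReal.toReal_ofReal (intervalIntegral.integral_nonneg hS fun s _ => by positivity),
    ENNReal.toReal_ofReal (intervalIntegral.integral_nonneg hS fun s _ => by positivity)]
  have cx := hu.deriv_x.continuousOn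
  have cx' := hu'.deriv_x.continuousOn
  have dy := hu'.deriv_y.sub hu.deriv_y
  have h1 := integral_pairing hφ hψ (hu'.deriv_x.sub hu.deriv_x) dy hS
  simp only [hpS, Prod.fst_zero, Prod.snd_zero, inner_zero_left, add_zero, zero_sub, hu.init,
    hu'.init] at h1
  have h2 : ∫ t in (0 : ℝ)..S, inner ℝ (p t).2 (u' t - u t) ≤ ∫ _ in (0 : ℝ)..S, (0 : ℝ) := by
    refine intervalIntegral.integral_mono_ae_restrict hS
      (dy.intervalIntegrable_inner_right hψ.continuousOn le_rfl hS) (by simp) ?_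
    have hsub : Icc 0 S ⊆ Ici (0 : ℝ) := fun t ht => ht.1
    filter_upwards [ae_restrict_of_ae_restrict_of_subset hsub hmax,
      ae_restrict_of_ae_restrict_of_subset hsub hu'.mem] with t m1 m2
    have e1 : (inner ℝ (p t).2 (u' t) : ℝ) ≤ inner ℝ (p t).2 (u t) := m1 m2
    rw [inner_sub_right]
    linarith
  rw [intervalIntegral.integral_zero] at h2
  have i1 : IntervalIntegrable (fun t => ‖(q t).1‖ ^ 2) volume 0 S :=
    intervalIntegrable_of_continuousOn_Ici (cx.norm.pow 2) le_rfl hS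
  have i2 : IntervalIntegrable (fun t => ‖(q' t).1‖ ^ 2) volume 0 S :=
    intervalIntegrable_of_continuousOn_Ici (cx'.norm.pow 2) le_rfl hS
  have i3 : IntervalIntegrable (fun t => (inner ℝ ((q' t).1 - (q t).1) (q t).1 : ℝ)) volume 0 S :=
    intervalIntegrable_of_continuousOn_Ici ((cx'.sub cx).inner cx) le_rfl hS
  -- Convexity of the square; the linear term is then evaluated by the pairing identity, whose
  -- control term has the sign fixed in `h2`.
  have h3 : (∫ t in (0 : ℝ)..S, ‖(q t).1‖ ^ 2) +
      2 * ∫ t in (0 : ℝ)..S, inner ℝ ((q' t).1 - (q t).1) (q t).1 ≤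
        ∫ t in (0 : ℝ)..S, ‖(q' t).1‖ ^ 2 := by
    rw [← intervalIntegral.integral_const_mul, ← intervalIntegral.integral_add i1 (i3.const_mul _)]
    refine intervalIntegral.integral_mono_on hS (i1.add (i3.const_mul _)) i2 fun t _ => ?_
    have e1 := norm_add_sq_real (q t).1 ((q' t).1 - (q t).1)
    rw [add_sub_cancel, real_inner_comm] at e1
    nlinarith [sq_nonneg ‖(q' t).1 - (q t).1‖]
  rw [covector_apply, Prod.fst_sub, Prod.snd_sub]
  linarith

/-! ### Lipschitz and gauge estimates for `E` -/

theorem sq_integral_le {f : ℝ → ℝ} {S : ℝ} (hS : 0 ≤ S) (hf : ContinuousOn f (Ici 0)) :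
    (∫ t in (0 : ℝ)..S, f t) ^ 2 ≤ S * ∫ t in (0 : ℝ)..S, f t ^ 2 := by
  rcases hS.eq_or_lt with rfl | hS0
  · simp
  set m := ∫ t in (0 : ℝ)..S, f t with hm
  have i1 : IntervalIntegrable f volume 0 S := intervalIntegrable_of_continuousOn_Ici hf le_rfl hS
  have i2 : IntervalIntegrable (fun t => f t ^ 2) volume 0 S :=
    intervalIntegrable_of_continuousOn_Ici (hf.pow 2) le_rfl hS
  have h1 : ∫ t in (0 : ℝ)..S, (S * f t - m) ^ 2 =
      S ^ 2 * (∫ t in (0 : ℝ)..S, f t ^ 2) - 2 * S * m * m + S * m ^ 2 := by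
    have e : ∀ t, (S * f t - m) ^ 2 = S ^ 2 * f t ^ 2 - 2 * S * m * f t + m ^ 2 := fun t => by ring
    simp only [e]
    rw [intervalIntegral.integral_add ((i2.const_mul _).sub (i1.const_mul _)) (by simp),
      intervalIntegral.integral_sub (i2.const_mul _) (i1.const_mul _),
      intervalIntegral.integral_const_mul, intervalIntegral.integral_const_mul, ← hm]
    simp
  have h2 : 0 ≤ ∫ t in (0 : ℝ)..S, (S * f t - m) ^ 2 :=
    intervalIntegral.integral_nonneg hS fun t _ => by positivity
  rw [h1] at h2
  have h3 : 0 ≤ S * (S * (∫ t in (0 : ℝ)..S, f t ^ 2) - m ^ 2) := by linarith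
  linarith [nonneg_of_mul_nonneg_right h3 hS0]

/-- Bound of a solution of the adjoint equations that vanishes at time `S`. -/
theorem norm_le_of_solvesDeriv {φ ψ ξ : ℝ → Plane} (hφ : SolvesDeriv φ ξ)
    (hψ : SolvesDeriv ψ fun t => -φ t) {S A : ℝ} (hS : 0 ≤ S) (hφS : φ S = 0) (hψS : ψ S = 0)
    (hA : ∫ t in (0 : ℝ)..S, ‖ξ t‖ ≤ A) : ‖φ 0‖ ≤ A ∧ ‖ψ 0‖ ≤ S * A := by
  have h1 : ∀ t, 0 ≤ t → t ≤ S → ‖φ t‖ ≤ A := by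
    intro t ht htS
    have e := hφ.sub_eq ht hS
    rw [hφS, zero_sub] at e
    rw [← norm_neg, e]
    refine (intervalIntegral.norm_integral_le_integral_norm htS).trans (le_trans ?_ hA)
    have i := fun {a b : ℝ} (ha : 0 ≤ a) (hb : 0 ≤ b) => (hφ.intervalIntegrable ha hb).norm
    rw [← intervalIntegral.integral_add_adjacent_intervals (i le_rfl ht) (i ht hS)]
    have : 0 ≤ ∫ s in (0 : ℝ)..t, ‖ξ s‖ :=
      intervalIntegral.integral_nonneg ht fun s _ => norm_nonneg _
    linarith
  refine ⟨h1 0 le_rfl hS, ?_⟩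
  have e := hψ.sub_eq le_rfl hS
  rw [hψS, zero_sub] at e
  rw [← norm_neg, e]
  have h2 : ‖∫ s in (0 : ℝ)..S, -φ s‖ ≤ A * |S - 0| := by
    refine intervalIntegral.norm_integral_le_of_norm_le_const fun s hs => ?_
    rw [uIoc_of_le hS] at hs
    rw [norm_neg]
    exact h1 s hs.1.le hs.2
  rw [sub_zero, abs_of_nonneg hS] at h2
  linarith

/-- The difference `D` of initial adjoints is controlled by `∫|δx|`, hence `D²` by `∫|δx|²`, which
monotonicity bounds by a multiple of `D|δq|`; one factor `D` cancels. -/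
theorem IsAdjoint.norm_sub_le {Ω : Set Plane} (hzero : (0 : Plane) ∈ interior Ω)
    {q₀ q₀' : Phase} {q p q' p' : ℝ → Phase} (h : IsAdjoint Ω q₀ q p)
    (h' : IsAdjoint Ω q₀' q' p') {S : ℝ} (hS : 0 ≤ S) (hq : ∀ t, S ≤ t → q t = 0)
    (hq' : ∀ t, S ≤ t → q' t = 0) :
    ‖p 0 - p' 0‖ ≤ 2 * (1 + S) ^ 2 * S * ‖q₀ - q₀'‖ := by
  have hpS := h.eq_zero hzero hS hq le_rfl
  have hpS' := h'.eq_zero hzero hS hq' le_rfl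
  have h1 := h.integral_norm_sub_sq_le h' hS hpS hpS'
  have h2 := (neg_le_abs _).trans (abs_covector_le (p 0 - p' 0) (q₀ - q₀'))
  have dφ := h.1.sub h'.1
  have dψ : SolvesDeriv (fun t => (p t).2 - (p' t).2) (fun t => -((p t).1 - (p' t).1)) := by
    refine (h.2.1.sub h'.2.1).congr (fun _ _ => rfl) fun t _ => ?_
    simp only
    abel
  obtain ⟨u, hu, -⟩ := h.2.2
  obtain ⟨u', hu', -⟩ := h'.2.2
  have hcs := sq_integral_le hS (hu.deriv_x.sub hu'.deriv_x).continuousOn.norm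
  have h3 := norm_le_of_solvesDeriv dφ dψ hS (by simp [hpS, hpS']) (by simp [hpS, hpS']) le_rfl
  set m := ∫ t in (0 : ℝ)..S, ‖(q t).1 - (q' t).1‖ with hm
  have hm0 : 0 ≤ m := intervalIntegral.integral_nonneg hS fun t _ => norm_nonneg _
  set D := ‖p 0 - p' 0‖ with hD
  have hD0 : 0 ≤ D := norm_nonneg _
  have h4 : D ≤ (1 + S) * m := norm_prod_le_iff.2 ⟨by
    rw [Prod.fst_sub]; nlinarith [h3.1], by rw [Prod.snd_sub]; nlinarith [h3.2]⟩
  have h5 : D * D ≤ 2 * (1 + S) ^ 2 * S * ‖q₀ - q₀'‖ * D := by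
    calc D * D ≤ ((1 + S) * m) * ((1 + S) * m) := by gcongr
      _ = (1 + S) ^ 2 * m ^ 2 := by ring
      _ ≤ (1 + S) ^ 2 * (S * (2 * D * ‖q₀ - q₀'‖)) := by
        gcongr
        refine hcs.trans ?_
        gcongr
        exact h1.trans h2
      _ = _ := by ring
  rcases hD0.eq_or_lt with h0 | h0
  · rw [← h0]; positivity
  · exact le_of_mul_le_mul_right h5 h0

theorem norm_fst_le_gaugeP_pow (p : Phase) : ‖p.1‖ ≤ gaugeP p ^ 3 := by
  calc ‖p.1‖ = (‖p.1‖ ^ (1 / 3 : ℝ)) ^ 3 := by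
        rw [← Real.rpow_natCast, ← Real.rpow_mul (norm_nonneg _)]
        norm_num
    _ ≤ _ := by
      gcongr
      exact le_max_left _ _

theorem norm_snd_le_gaugeP_pow (p : Phase) : ‖p.2‖ ≤ gaugeP p ^ 4 := by
  calc ‖p.2‖ = (‖p.2‖ ^ (1 / 4 : ℝ)) ^ 4 := by
        rw [← Real.rpow_natCast, ← Real.rpow_mul (norm_nonneg _)]
        norm_num
    _ ≤ _ := by
      gcongr
      exact le_max_right _ _

theorem gaugeP_le {p : Phase} {a : ℝ} (ha : 0 ≤ a) (h1 : ‖p.1‖ ≤ a ^ 3) (h2 : ‖p.2‖ ≤ a ^ 4) :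
    gaugeP p ≤ a := by
  refine max_le ?_ ?_
  · calc ‖p.1‖ ^ (1 / 3 : ℝ) ≤ (a ^ 3) ^ (1 / 3 : ℝ) :=
          Real.rpow_le_rpow (norm_nonneg _) h1 (by norm_num)
      _ = a := by
        rw [← Real.rpow_natCast, ← Real.rpow_mul ha]
        norm_num
  · calc ‖p.2‖ ^ (1 / 4 : ℝ) ≤ (a ^ 4) ^ (1 / 4 : ℝ) :=
          Real.rpow_le_rpow (norm_nonneg _) h2 (by norm_num)
      _ = a := by
        rw [← Real.rpow_natCast, ← Real.rpow_mul ha]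
        norm_num

/-- Below: `c g⁵ ≤ |⟨p, q⟩| ≤ P³g² + P⁴g`. Above: `|x|` is of order `g²` during a time of order `g`,
and the adjoint equations integrate it twice from zero data. -/
theorem exists_gaugeP_bounds {Ω : Set Plane} (hcomp : IsCompact Ω)
    (hzero : (0 : Plane) ∈ interior Ω) : ∃ C₃ C₄ : ℝ, 0 < C₃ ∧ 0 < C₄ ∧
      ∀ (q₀ : Phase) (q p : ℝ → Phase), IsOptimal Ω q₀ q → IsAdjoint Ω q₀ q p →
        C₃ * gaugeQ q₀ ≤ gaugeP (p 0) ∧ gaugeP (p 0) ≤ C₄ * gaugeQ q₀ := by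
  obtain ⟨c, hc, hlow⟩ := exists_gaugeQ_pow_le hcomp hzero
  obtain ⟨C, hC, hbd⟩ := exists_gaugeQ_le hcomp hzero
  obtain ⟨C₂, hC₂, hext⟩ := exists_extinction hcomp hzero
  set A := 1 + C₂ * C ^ 2 + C₂ ^ 2 * C ^ 2 with hA
  have hA1 : 1 ≤ A := by
    have : 0 ≤ C₂ * C ^ 2 + C₂ ^ 2 * C ^ 2 := by positivity
    linarith
  -- Small enough that `d³ + d⁴ < c`, which contradicts the lower estimate if `P < d g`.
  set d := min 1 c / 2 with hd
  have hd0 : 0 < d := by positivity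
  have hd1 : d ≤ 1 / 2 := by
    have := min_le_left 1 c
    linarith
  have hdc : d ≤ c / 2 := by
    have := min_le_right 1 c
    linarith
  refine ⟨d, A, hd0, by linarith, fun q₀ q p h hp => ⟨?_, ?_⟩⟩
  · set g := gaugeQ q₀ with hg
    set P := gaugeP (p 0) with hP
    have hP0 : 0 ≤ P := le_max_of_le_left (Real.rpow_nonneg (norm_nonneg _) _)
    have hg0 : 0 ≤ g := gaugeQ_nonneg _
    by_contra! hlt
    have hgpos : 0 < g := by
      rcases hg0.eq_or_lt with h0 | h0
      · rw [← h0, mul_zero] at hlt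
        linarith
      · exact h0
    have h1 := (hlow q₀ q p h hp).trans ((neg_le_abs _).trans (abs_covector_le_add _ _))
    have h2 : ‖(p 0).1‖ * ‖q₀.1‖ + ‖(p 0).2‖ * ‖q₀.2‖ ≤ P ^ 3 * g ^ 2 + P ^ 4 * g := by
      have e1 := norm_fst_le_gaugeP_pow (p 0)
      have e2 := norm_snd_le_gaugeP_pow (p 0)
      have e3 := norm_fst_le_gaugeQ_sq q₀
      have e4 := norm_snd_le_gaugeQ q₀
      gcongr
    have h3 : P ^ 3 * g ^ 2 + P ^ 4 * g ≤ (d * g) ^ 3 * g ^ 2 + (d * g) ^ 4 * g := by gcongr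
    have h4 : (d * g) ^ 3 * g ^ 2 + (d * g) ^ 4 * g = (d ^ 3 + d ^ 4) * g ^ 5 := by ring
    have h5 : d ^ 3 + d ^ 4 < c := by
      have e1 : d ^ 3 ≤ (1 / 2) ^ 2 * d := by
        calc d ^ 3 = d ^ 2 * d := by ring
          _ ≤ _ := by gcongr
      have e2 : d ^ 4 ≤ (1 / 2) ^ 3 * d := by
        calc d ^ 4 = d ^ 3 * d := by ring
          _ ≤ _ := by gcongr
      linarith
    have h6 : 0 < g ^ 5 := by positivity
    have h7 := mul_lt_mul_of_pos_right h5 h6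
    linarith
  · set g := gaugeQ q₀ with hg
    have hg0 : 0 ≤ g := gaugeQ_nonneg _
    set S := C₂ * g with hS
    have hS0 : 0 ≤ S := by positivity
    have hpS := hp.eq_zero hzero hS0 (hext q₀ q h) le_rfl
    have h1 : ∫ t in (0 : ℝ)..S, ‖(q t).1‖ ≤ (C * g) ^ 2 * S := by
      have h2 : ‖∫ t in (0 : ℝ)..S, ‖(q t).1‖‖ ≤ (C * g) ^ 2 * |S - 0| := by
        refine intervalIntegral.norm_integral_le_of_norm_le_const fun t ht => ?_
        rw [uIoc_of_le hS0] at ht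
        rw [norm_norm]
        refine (norm_fst_le_gaugeQ_sq _).trans ?_
        have e1 := hbd q₀ q h t ht.1.le
        have e2 := gaugeQ_nonneg (q t)
        gcongr
      rw [sub_zero, abs_of_nonneg hS0] at h2
      exact (le_abs_self _).trans h2
    have h2 := norm_le_of_solvesDeriv hp.1 hp.2.1 hS0 (by simp [hpS]) (by simp [hpS]) h1
    refine gaugeP_le (by positivity) (h2.1.trans ?_) (h2.2.trans ?_)
    · calc (C * g) ^ 2 * S = (C₂ * C ^ 2) * g ^ 3 := by rw [hS]; ring
        _ ≤ A * g ^ 3 := by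
          have : 0 ≤ C₂ ^ 2 * C ^ 2 := by positivity
          gcongr
          linarith
        _ ≤ A ^ 3 * g ^ 3 := by
          gcongr
          exact le_self_pow₀ hA1 (by norm_num)
        _ = _ := by ring
    · calc S * ((C * g) ^ 2 * S) = (C₂ ^ 2 * C ^ 2) * g ^ 4 := by rw [hS]; ring
        _ ≤ A * g ^ 4 := by
          have : 0 ≤ C₂ * C ^ 2 := by positivity
          gcongr
          linarith
        _ ≤ A ^ 4 * g ^ 4 := by
          gcongr
          exact le_self_pow₀ hA1 (by norm_num)
        _ = _ := by ring

/-- The map `E` given by the initial values of adjoint functions is locally Lipschitz. -/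
theorem locallyLipschitz_adjoint {Ω : Set Plane} (hcomp : IsCompact Ω)
    (hzero : (0 : Plane) ∈ interior Ω) {qhat phat : Phase → ℝ → Phase}
    (hq : ∀ q₀, IsOptimal Ω q₀ (qhat q₀)) (hp : ∀ q₀, IsAdjoint Ω q₀ (qhat q₀) (phat q₀)) :
    LocallyLipschitz fun q₀ => phat q₀ 0 := by
  obtain ⟨C, hC, hext⟩ := exists_extinction hcomp hzero
  intro q₀
  -- One extinction time valid for all initial points near `q₀`.
  set S := C * (gaugeQ q₀ + 1) with hS
  have hS0 : 0 ≤ S := mul_nonneg hC.le (by linarith [gaugeQ_nonneg q₀])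
  refine ⟨⟨2 * (1 + S) ^ 2 * S, by positivity⟩, {q | gaugeQ q < gaugeQ q₀ + 1},
    (isOpen_lt continuous_gaugeQ continuous_const).mem_nhds (by simp), ?_⟩
  have h0 : ∀ q, gaugeQ q < gaugeQ q₀ + 1 → ∀ t, S ≤ t → qhat q t = 0 := by
    intro q hlt t ht
    refine hext _ _ (hq q) t (le_trans ?_ ht)
    rw [hS]
    gcongr
  refine LipschitzOnWith.of_dist_le_mul fun q hlt q' hlt' => ?_
  rw [dist_eq_norm, dist_eq_norm]
  exact (hp q).norm_sub_le hzero (hp q') hS0 (h0 q hlt) (h0 q' hlt')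

/-! ### Continuity of optimal trajectories and of the hitting time -/

/-- Optimal trajectories depend continuously on the initial point. -/
theorem continuous_optimal {Ω : Set Plane} (hcomp : IsCompact Ω)
    (hzero : (0 : Plane) ∈ interior Ω) {qhat phat : Phase → ℝ → Phase}
    (hq : ∀ q₀, IsOptimal Ω q₀ (qhat q₀)) (hp : ∀ q₀, IsAdjoint Ω q₀ (qhat q₀) (phat q₀))
    {t : ℝ} (ht : 0 ≤ t) : Continuous fun q₀ => qhat q₀ t := by
  obtain ⟨c, hc, hmono⟩ := exists_gaugeQ_sub_pow_le hcomp hzero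
  have hE := (locallyLipschitz_adjoint hcomp hzero hq hp).continuous
  refine continuous_iff_continuousAt.2 fun q₀ => ?_
  have h1 : ∀ q, gaugeQ (qhat q t - qhat q₀ t) ≤
      (2 * ‖phat q 0 - phat q₀ 0‖ * ‖q - q₀‖ / c) ^ (1 / 5 : ℝ) := by
    intro q
    have h2 := (hmono _ _ _ _ _ _ (hq q) (hq q₀) (hp q) (hp q₀) t ht).trans
      ((neg_le_abs _).trans (abs_covector_le _ _))
    have h3 := gaugeQ_nonneg (qhat q t - qhat q₀ t)
    calc gaugeQ (qhat q t - qhat q₀ t) = (gaugeQ (qhat q t - qhat q₀ t) ^ 5) ^ (1 / 5 : ℝ) :=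
          (rpow_fifth_of_pow h3).symm
      _ ≤ _ := by
        refine Real.rpow_le_rpow (by positivity) ?_ (by norm_num)
        rw [le_div_iff₀ hc]
        linarith
  have h2 : Tendsto (fun q => (2 * ‖phat q 0 - phat q₀ 0‖ * ‖q - q₀‖ / c) ^ (1 / 5 : ℝ))
      (𝓝 q₀) (𝓝 0) := by
    have h3 : Continuous fun q => (2 * ‖phat q 0 - phat q₀ 0‖ * ‖q - q₀‖ / c) ^ (1 / 5 : ℝ) := by
      refine Continuous.rpow_const ?_ fun _ => Or.inr (by norm_num)
      fun_prop
    have h4 := h3.tendsto q₀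
    simpa using h4
  have h3 : Tendsto (fun q => gaugeQ (qhat q t - qhat q₀ t)) (𝓝 q₀) (𝓝 0) :=
    squeeze_zero (fun _ => gaugeQ_nonneg _) h1 h2
  have h4 : Tendsto (fun q => qhat q t - qhat q₀ t) (𝓝 q₀) (𝓝 0) := by
    refine squeeze_zero_norm (fun q => norm_le_gaugeQ_sq_add _) ?_
    simpa using (h3.pow 2).add h3
  exact tendsto_sub_nhds_zero_iff.1 h4

/-- From below: being away from the origin at time `a` is an open condition. From above: after time
`T = hitTime (qhat q₀)` a nearby trajectory needs at most `C` times its gauge at `T`, which tends to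
zero. -/
theorem continuous_hitTime {Ω : Set Plane} (hcomp : IsCompact Ω)
    (hzero : (0 : Plane) ∈ interior Ω) {qhat phat : Phase → ℝ → Phase}
    (hq : ∀ q₀, IsOptimal Ω q₀ (qhat q₀)) (hp : ∀ q₀, IsAdjoint Ω q₀ (qhat q₀) (phat q₀)) :
    Continuous fun q₀ => hitTime (qhat q₀) := by
  obtain ⟨C, hC, hext⟩ := exists_extinction hcomp hzero
  refine continuous_iff_continuousAt.2 fun q₀ => tendsto_order.2 ⟨fun a ha => ?_, fun b hb => ?_⟩
  · rcases lt_or_ge a 0 with h0 | h0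
    · exact Eventually.of_forall fun q => h0.trans_le (hitTime_nonneg _)
    have hne : qhat q₀ a ≠ 0 := fun h => not_le.2 ha (hitTime_le h0 h)
    filter_upwards [(continuous_optimal hcomp hzero hq hp h0).continuousAt.eventually_ne hne]
      with q hqa
    by_contra! hle
    exact hqa ((hq q).eq_zero_of_hitTime_le hcomp hzero hle)
  · set T := hitTime (qhat q₀) with hT
    have hT0 : 0 ≤ T := hitTime_nonneg _
    have hle : ∀ q, hitTime (qhat q) ≤ T + C * gaugeQ (qhat q T) := by
      intro q
      have hg : 0 ≤ C * gaugeQ (qhat q T) := mul_nonneg hC.le (gaugeQ_nonneg _)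
      refine hitTime_le (add_nonneg hT0 hg) ?_
      rw [add_comm]
      exact hext _ _ ((hq q).shift hzero hT0) _ le_rfl
    have hcont : Continuous fun q => T + C * gaugeQ (qhat q T) :=
      continuous_const.add (continuous_const.mul
        (continuous_gaugeQ.comp (continuous_optimal hcomp hzero hq hp hT0)))
    have h0 : T + C * gaugeQ (qhat q₀ T) < b := by
      rw [(hq q₀).apply_hitTime hcomp hzero, gaugeQ_zero]
      simpa using hb
    filter_upwards [hcont.continuousAt.eventually_lt_const h0] with q hlt
    exact (hle q).trans_lt hlt

/-! ### Differentiability of the Bellman function and bijectivity of `E` -/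

theorem hasFDerivAt_bellman {Ω : Set Plane} (hcomp : IsCompact Ω)
    (hzero : (0 : Plane) ∈ interior Ω) {qhat phat : Phase → ℝ → Phase}
    (hq : ∀ q₀, IsOptimal Ω q₀ (qhat q₀)) (hp : ∀ q₀, IsAdjoint Ω q₀ (qhat q₀) (phat q₀))
    (q₀ : Phase) :
    HasFDerivAt (fun q => (bellman Ω q).toReal) (-covector (phat q₀ 0)) q₀ := by
  have hE := (locallyLipschitz_adjoint hcomp hzero hq hp).continuous
  rw [hasFDerivAt_iff_isLittleO, Asymptotics.isLittleO_iff]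
  intro ε hε
  have h1 : Tendsto (fun q => 2 * ‖phat q 0 - phat q₀ 0‖) (𝓝 q₀) (𝓝 0) := by
    have h2 : Continuous fun q => 2 * ‖phat q 0 - phat q₀ 0‖ := by fun_prop
    simpa using h2.tendsto q₀
  filter_upwards [h1.eventually_lt_const hε] with q hlt
  -- The subgradient inequalities at `q₀` and at `q` enclose the increment of `B` between two linear
  -- terms, whose gap is small by continuity of `E`.
  have e1 := (hq q₀).toReal_bellman_sub_le hcomp hzero (hq q) (hp q₀)
  have e2 := (hq q).toReal_bellman_sub_le hcomp hzero (hq q₀) (hp q)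
  have e3 := abs_covector_le (phat q 0 - phat q₀ 0) (q - q₀)
  have e4 : covector (phat q 0 - phat q₀ 0) (q - q₀) =
      covector (phat q 0) (q - q₀) - covector (phat q₀ 0) (q - q₀) := by
    rw [covector_sub]
    rfl
  have e5 : covector (phat q 0) (q₀ - q) = -covector (phat q 0) (q - q₀) := by
    rw [← map_neg, neg_sub]
  have e6 : 2 * ‖phat q 0 - phat q₀ 0‖ * ‖q - q₀‖ ≤ ε * ‖q - q₀‖ := by gcongr
  rw [e4] at e3
  have e7 := neg_le_abs (covector (phat q 0) (q - q₀) - covector (phat q₀ 0) (q - q₀))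
  rw [neg_apply, Real.norm_eq_abs, abs_le]
  constructor <;> linarith

theorem tendsto_gaugeQ_cocompact : Tendsto gaugeQ (cocompact Phase) atTop := by
  refine tendsto_atTop.2 fun R => ?_
  filter_upwards [(tendsto_norm_cocompact_atTop (E := Phase)).eventually_gt_atTop (R ^ 2 + R)]
    with q hlt
  by_contra! h
  have h1 := norm_le_gaugeQ_sq_add q
  have h2 := gaugeQ_nonneg q
  nlinarith

/-- `B` grows like `g⁵` while a linear form grows at most like `g²`, so `B + p` attains its minimum,
and there `B' = -p`. -/
theorem surjective_adjoint {Ω : Set Plane} (hcomp : IsCompact Ω)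
    (hzero : (0 : Plane) ∈ interior Ω) {qhat phat : Phase → ℝ → Phase}
    (hq : ∀ q₀, IsOptimal Ω q₀ (qhat q₀)) (hp : ∀ q₀, IsAdjoint Ω q₀ (qhat q₀) (phat q₀)) :
    Function.Surjective fun q₀ => phat q₀ 0 := by
  intro p
  obtain ⟨ε, c, C, -, hc, -, hE⟩ := exists_energy_bounds hcomp hzero
  have hd := hasFDerivAt_bellman hcomp hzero hq hp
  set F : Phase → ℝ := fun q => (bellman Ω q).toReal + covector p q with hF
  have hdF : ∀ q, HasFDerivAt F (-covector (phat q 0) + covector p) q := fun q =>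
    (hd q).add (covector p).hasFDerivAt
  have hlow : ∀ q, c / 2 * gaugeQ q ^ 5 ≤ (bellman Ω q).toReal := by
    intro q
    have h1 := (hE q _ (hq q) 0 le_rfl).1
    rw [(hp q).init] at h1
    rw [(hq q).toReal_bellman]
    linarith
  have hF0 : F 0 = 0 := by
    simp [hF, (IsOptimal.zero (interior_subset hzero)).toReal_bellman,
      tailEnergy_eq_zero_of_forall]
  have hcoer : ∀ᶠ q in cocompact Phase, F 0 ≤ F q := by
    filter_upwards [tendsto_gaugeQ_cocompact.eventually_ge_atTop (max 1 (4 * ‖p‖ / c))] with q hR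
    set g := gaugeQ q with hg
    have hg1 : 1 ≤ g := (le_max_left _ _).trans hR
    have hgp : 4 * ‖p‖ ≤ g * c := by
      rw [← div_le_iff₀ hc]
      exact (le_max_right _ _).trans hR
    have h1 : |covector p q| ≤ ‖p‖ * g ^ 2 + ‖p‖ * g := by
      refine (abs_covector_le_add p q).trans ?_
      have e1 := norm_fst_le p
      have e2 := norm_snd_le p
      have e3 := norm_fst_le_gaugeQ_sq q
      have e4 := norm_snd_le_gaugeQ q
      gcongr
    have h2 : ‖p‖ * g ^ 2 ≤ ‖p‖ * g ^ 4 := by gcongr; norm_num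
    have h3 : ‖p‖ * g ≤ ‖p‖ * g ^ 4 := by
      gcongr
      exact le_self_pow₀ hg1 (by norm_num)
    have h4 : 4 * ‖p‖ * g ^ 4 ≤ g * c * g ^ 4 := by gcongr
    have h5 := hlow q
    have h6 := neg_abs_le (covector p q)
    rw [hF0]
    change 0 ≤ (bellman Ω q).toReal + covector p q
    nlinarith
  have hcont : Continuous F := continuous_iff_continuousAt.2 fun q => (hdF q).continuousAt
  obtain ⟨q, hmin⟩ := hcont.exists_forall_le' 0 hcoer
  refine ⟨q, covector_injective ?_⟩
  have h0 : IsLocalMin F q := Eventually.of_forall hmin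
  have h1 := h0.hasFDerivAt_eq_zero (hdF q)
  exact neg_add_eq_zero.1 h1

theorem injective_adjoint {Ω : Set Plane} (hcomp : IsCompact Ω)
    (hzero : (0 : Plane) ∈ interior Ω) {qhat phat : Phase → ℝ → Phase}
    (hq : ∀ q₀, IsOptimal Ω q₀ (qhat q₀)) (hp : ∀ q₀, IsAdjoint Ω q₀ (qhat q₀) (phat q₀)) :
    Function.Injective fun q₀ => phat q₀ 0 := by
  obtain ⟨c, hc, hmono⟩ := exists_gaugeQ_sub_pow_le hcomp hzero
  intro q q' heq
  have h1 := hmono _ _ _ _ _ _ (hq q) (hq q') (hp q) (hp q') 0 le_rfl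
  rw [(hp q).init, (hp q').init, covector_apply, show phat q 0 = phat q' 0 from heq] at h1
  simp only [sub_self, Prod.fst_zero, Prod.snd_zero, inner_zero_left, add_zero, neg_zero] at h1
  have h2 : gaugeQ (q - q') ^ 5 ≤ 0 := by nlinarith
  have h3 : gaugeQ (q - q') = 0 :=
    pow_eq_zero_iff (by norm_num) |>.1 (le_antisymm h2 (pow_nonneg (gaugeQ_nonneg _) _))
  exact sub_eq_zero.1 (gaugeQ_eq_zero.1 h3)

/-- The pairing `-⟨p, q⟩` is bounded below by `c g⁵` at every time, since the tail of an extremal is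
an extremal. -/
theorem IsOptimal.adjoint_ne_zero {Ω : Set Plane} (hcomp : IsCompact Ω)
    (hzero : (0 : Plane) ∈ interior Ω) {q₀ : Phase} {q p : ℝ → Phase} (h : IsOptimal Ω q₀ q)
    (hp : IsAdjoint Ω q₀ q p) {t : ℝ} (ht : 0 ≤ t) (hqt : q t ≠ 0) : p t ≠ 0 := by
  obtain ⟨c, hc, hlow⟩ := exists_gaugeQ_pow_le hcomp hzero
  intro hpt
  have h1 := hlow _ _ _ (h.shift hzero ht) (hp.shift ht)
  rw [zero_add, hpt, covector_apply] at h1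
  simp only [Prod.fst_zero, Prod.snd_zero, inner_zero_left, add_zero, neg_zero] at h1
  have h2 : gaugeQ (q t) ^ 5 ≤ 0 := by nlinarith
  exact hqt (gaugeQ_eq_zero.1
    (pow_eq_zero_iff (by norm_num) |>.1 (le_antisymm h2 (pow_nonneg (gaugeQ_nonneg _) _))))

end ModelProblem

/-! ### Assembly of the theorem -/

open ModelProblem in
theorem mainTheorem1 (Ω : Set ModelProblem.Plane) (hconv : Convex ℝ Ω) (hcomp : IsCompact Ω)
    (hzero : (0 : ModelProblem.Plane) ∈ interior Ω) :
    ∃ (qhat phat : ModelProblem.Phase → ℝ → ModelProblem.Phase) (T : ModelProblem.Phase → ℝ),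
      -- existence and uniqueness of the optimal trajectory, with finite value
      (∀ q₀, ModelProblem.IsOptimal Ω q₀ (qhat q₀) ∧ ModelProblem.bellman Ω q₀ < ∞ ∧
        ∀ q, ModelProblem.IsOptimal Ω q₀ q → EqOn q (qhat q₀) (Ici 0)) ∧
      -- existence and uniqueness of the adjoint function
      (∀ q₀, ModelProblem.IsAdjoint Ω q₀ (qhat q₀) (phat q₀) ∧
        ∀ p, ModelProblem.IsAdjoint Ω q₀ (qhat q₀) p → EqOn p (phat q₀) (Ici 0)) ∧
      -- the hitting time of the origin
      (∀ q₀, 0 ≤ T q₀ ∧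
        (∀ t, T q₀ ≤ t → qhat q₀ t = 0 ∧ phat q₀ t = 0) ∧
        (∀ t, 0 ≤ t → t < T q₀ → qhat q₀ t ≠ 0 ∧ phat q₀ t ≠ 0)) ∧
      Continuous T ∧
      (∃ C₁ C₂ : ℝ, 0 < C₁ ∧ 0 < C₂ ∧ ∀ q₀,
        C₁ * ModelProblem.gaugeQ q₀ ≤ T q₀ ∧ T q₀ ≤ C₂ * ModelProblem.gaugeQ q₀) ∧
      -- the map `E : q₀ ↦ p̂(0, q₀) = -B′(q₀)`
      (∀ q₀, HasFDerivAt (fun q => (ModelProblem.bellman Ω q).toReal)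
        (-ModelProblem.covector (phat q₀ 0)) q₀) ∧
      LocallyLipschitz (fun q₀ => phat q₀ 0) ∧
      Function.Bijective (fun q₀ => phat q₀ 0) ∧
      (∃ C₃ C₄ : ℝ, 0 < C₃ ∧ 0 < C₄ ∧ ∀ q₀,
        C₃ * ModelProblem.gaugeQ q₀ ≤ ModelProblem.gaugeP (phat q₀ 0) ∧
          ModelProblem.gaugeP (phat q₀ 0) ≤ C₄ * ModelProblem.gaugeQ q₀) := by
  choose qhat hq using exists_isOptimal hconv hcomp hzero
  have hp : ∀ q₀, IsAdjoint Ω q₀ (qhat q₀) (adjointOf (qhat q₀)) := fun q₀ =>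
    (hq q₀).isAdjoint_adjointOf hconv hcomp hzero
  refine ⟨qhat, fun q₀ => adjointOf (qhat q₀), fun q₀ => hitTime (qhat q₀), fun q₀ => ⟨hq q₀, ?_,
    fun q h => h.eqOn hconv hcomp hzero (hq q₀)⟩, fun q₀ => ⟨hp q₀, fun p h =>
    h.eqOn hzero (hp q₀) (hitTime_nonneg _) fun _ ht =>
      (hq q₀).eq_zero_of_hitTime_le hcomp hzero ht⟩, fun q₀ => ⟨hitTime_nonneg _, fun t ht =>
    ⟨(hq q₀).eq_zero_of_hitTime_le hcomp hzero ht, (hq q₀).adjointOf_eq_zero hcomp hzero ht⟩,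
    fun t ht htT => ?_⟩, continuous_hitTime hcomp hzero hq hp, ?_,
    hasFDerivAt_bellman hcomp hzero hq hp, locallyLipschitz_adjoint hcomp hzero hq hp,
    ⟨injective_adjoint hcomp hzero hq hp, surjective_adjoint hcomp hzero hq hp⟩, ?_⟩
  · rw [(hq q₀).bellman_eq]
    exact ENNReal.mul_lt_top (by simp) ((hq q₀).tailEnergy_ne_top hzero).lt_top
  · have hne : qhat q₀ t ≠ 0 := fun h => not_le.2 htT (hitTime_le ht h)
    exact ⟨hne, (hq q₀).adjoint_ne_zero hcomp hzero (hp q₀) ht hne⟩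
  · obtain ⟨K, hK1, hK⟩ := exists_forall_norm_le hcomp
    obtain ⟨C, hC, hext⟩ := exists_extinction hcomp hzero
    refine ⟨K⁻¹, C, by positivity, hC, fun q₀ => ⟨?_, ?_⟩⟩
    · obtain ⟨u, hu⟩ := (hq q₀).1
      rw [inv_mul_le_iff₀ (by linarith)]
      exact hu.gaugeQ_le hK1 hK (hitTime_nonneg _) ((hq q₀).apply_hitTime hcomp hzero)
    · exact hitTime_le (mul_nonneg hC.le (gaugeQ_nonneg _)) (hext _ _ (hq q₀) _ le_rfl)
  · obtain ⟨C₃, C₄, h₃, h₄, hb⟩ := exists_gaugeP_bounds hcomp hzero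
    exact ⟨C₃, C₄, h₃, h₄, fun q₀ => hb q₀ _ _ (hq q₀) (hp q₀)⟩
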